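/- Let $G_\sigma$ be a connected signed graph: a finite multigraph $G$ (loops and multiple edges allowed), with vertex set $V$ and edge set $E$, together with a sign $\sigma(e)\in\{+,-\}$ for each edge $e$. A cycle is a simple closed path (a loop is a cycle of length $1$, two parallel links form a cycle of length $2$); it is balanced if it has an even number of negative edges, and a signed graph, or a connected component of one, is balanced if all its cycles are balanced. A bowtie is the union of two distinct unbalanced cycles which meet at a single vertex, or the union of two vertex-disjoint unbalanced cycles and a simple path which meets one cycle at each end and is otherwise disjoint from them. For $X\subseteq E$ let $c_0(X)$ be the number of balanced connected components of the signed subgraph with vertex set $V$ and edge set $X$. The signed-graphic matroid $M=M(G_\sigma)$ is the matroid on $E$ with rank function $\rho(X)=|V|-c_0(X)$; its nullity function is $\eta(X)=|X|-\rho(X)$, and $\rho(M)=\rho(E)$, $\eta(M)=\eta(E)$. Let $M^*$ be the dual matroid. For a matroid $N$ with nullity function $\eta_N$, the $r$-th generalized Hamming weight $d_r(N)$ is the minimum size of a subset $X$ of its ground set with $\eta_N(X)=r$. Let $\upsilon_r(G_\sigma)$ (the $r$-th cogirth) be the minimum number of edges whose removal results in a signed graph with $r$ balanced connected components, and $\lambda_r(G_\sigma)$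 (the $r$-th edge connectivity) the minimum number of edges whose removal results in a signed graph with $r+1$ connected components. A cutset of $G_\sigma$ is a set of edges whose removal increases the number of balanced connected components if $G_\sigma$ is unbalanced, and the number of connected components if $G_\sigma$ is balanced; a cocircuit of $G_\sigma$ is an inclusion-minimal cutset. A family $C_1,\dots,C_r$ of sets is non-redundant if $\bigcup_{i\ne j}C_i\subsetneq\bigcup_{i=1}^r C_i$ for every $j$. Then the following hold. (i) If $1\le r\le\eta(M)$, then $d_r(M)$ is the minimum number of edges in a union of $r$ non-redundant sets, each of which is the edge set of a balanced cycle or of a bowtie of $G_\sigma$. (ii) If $1\le r\le\rho(M)$, then $d_r(M^*)=\upsilon_r(G_\sigma)$ if $G_\sigma$ is unbalanced, and $d_r(M^*)=\lambda_r(G_\sigma)$ if $G_\sigma$ is balanced. (iii) If $1\le r\le\rho(M)$, then $d_r(M^*)$ is the minimum number of edges in a union of $r$ non-redundant cocircuits of $G_\sigma$. -/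

import Mathlib

open scoped Graph

/-! ### Generalized Hamming weights of a finite matroid -/

namespace Matroid

variable {β : Type*}

/-- The rank function of a finite matroid, with values in the natural numbers. -/
noncomputable def rkNat (M : Matroid β) (X : Set β) : ℕ := (M.eRk X).toNat

/-- The nullity `|X| - ρ(X)` of a subset of a finite matroid. (Since `ρ(X) ≤ |X|` for finite `X`,
the subtraction is never truncated.) -/
noncomputable def nullityNat (M : Matroid β) (X : Set β) : ℕ := X.ncard - M.rkNat X

/-- The `r`-th generalized Hamming weight `d_r(M)` of a finite matroid:
the least size of a set of nullity `r`. -/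
noncomputable def genHammingWeight (M : Matroid β) (r : ℕ) : ℕ :=
  sInf {n : ℕ | ∃ X : Set β, X ⊆ M.E ∧ M.nullityNat X = r ∧ X.ncard = n}

end Matroid

/-- A family of sets is non-redundant if leaving out any member makes the union strictly smaller. -/
def NonRedundant {β ι : Type*} (C : ι → Set β) : Prop :=
  ∀ j, (⋃ i ∈ {i | i ≠ j}, C i) ⊂ ⋃ i, C i

/-! ### Connected components, cycles and paths of a multigraph -/

namespace Graph

variable {α β : Type*}

/-- `y` can be reached from `x` along the edges of `G`. -/
def Reach (G : Graph α β) (x y : α) : Prop := Relation.ReflTransGen G.Adj x y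

/-- The vertex sets of the connected components of `G`. -/
def components (G : Graph α β) : Set (Set α) :=
  {S | ∃ x ∈ V(G), S = {y | G.Reach x y}}

/-- `W` and `C` are the vertex set and the edge set of a cycle of `G` (a simple closed path). The
indices are cyclic. A loop is a cycle of length one and two parallel links form a cycle of
length two. -/
def IsCycle (G : Graph α β) (W : Set α) (C : Set β) : Prop :=
  ∃ (n : ℕ) (v : Fin (n + 1) → α) (e : Fin (n + 1) → β),
    Function.Injective v ∧ Function.Injective e ∧
      (∀ i, G.IsLink (e i) (v i) (v (i + 1))) ∧ Set.range v = W ∧ Set.range e = C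

/-- `W` and `P` are the vertex set and the edge set of a simple path of `G`, of positive length,
with ends `x` and `y`. -/
def IsSimplePath (G : Graph α β) (x y : α) (W : Set α) (P : Set β) : Prop :=
  ∃ (n : ℕ) (v : Fin (n + 2) → α) (e : Fin (n + 1) → β),
    Function.Injective v ∧ (∀ i : Fin (n + 1), G.IsLink (e i) (v i.castSucc) (v i.succ)) ∧
      v 0 = x ∧ v (Fin.last (n + 1)) = y ∧ Set.range v = W ∧ Set.range e = P

end Graph

/-! ### Signed graphs -/

/-- A signed graph: a finite multigraph (loops and multiple edges are allowed) together with a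
sign for each edge. (Only the values of `sign` on the edge set of the graph matter.) -/
structure SignedGraph (α β : Type*) where
  graph : Graph α β
  sign : β → ℤˣ
  finite_vertexSet : V(graph).Finite
  finite_edgeSet : E(graph).Finite

namespace SignedGraph

variable {α β : Type*}

/-- The signed subgraph with all the vertices and with the edges that belong to `X`. -/
def restrict (G : SignedGraph α β) (X : Set β) : SignedGraph α β where
  graph := G.graph.restrict X
  sign := G.sign
  finite_vertexSet := G.finite_vertexSet
  finite_edgeSet := G.finite_edgeSet.subset Set.inter_subset_left

/-- The signed subgraph obtained by removing the edges in `X` (and no vertices). -/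
def deleteEdges (G : SignedGraph α β) (X : Set β) : SignedGraph α β where
  graph := G.graph.deleteEdges X
  sign := G.sign
  finite_vertexSet := G.finite_vertexSet
  finite_edgeSet := G.finite_edgeSet.subset Set.sdiff_subset

/-- A set of edges is even if it has an even number of negative edges. -/
def EvenNeg (G : SignedGraph α β) (C : Set β) : Prop :=
  Even {e ∈ C | G.sign e = -1}.ncard

/-- A connected signed graph (it has a vertex, and any two vertices are joined by a walk). -/
def Connected (G : SignedGraph α β) : Prop :=
  V(G.graph).Nonempty ∧ ∀ x ∈ V(G.graph), ∀ y ∈ V(G.graph), G.graph.Reach x y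

/-- A signed graph is balanced if each of its cycles has an even number of negative edges. -/
def Balanced (G : SignedGraph α β) : Prop :=
  ∀ W C, G.graph.IsCycle W C → G.EvenNeg C

/-- The number of connected components. -/
noncomputable def numComponents (G : SignedGraph α β) : ℕ :=
  G.graph.components.ncard

/-- The vertex sets of the balanced connected components, that is, of those components
all of whose cycles have an even number of negative edges. -/
def balancedComponents (G : SignedGraph α β) : Set (Set α) :=
  {S ∈ G.graph.components | ∀ W C, G.graph.IsCycle W C → W ⊆ S → G.EvenNeg C}

/-- The number of balanced connected components. -/
noncomputable def numBalanced (G : SignedGraph α β) : ℕ :=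
  G.balancedComponents.ncard

/-- `C` is the edge set of a balanced cycle. -/
def IsBalancedCycle (G : SignedGraph α β) (C : Set β) : Prop :=
  ∃ W, G.graph.IsCycle W C ∧ G.EvenNeg C

/-- `B` is the edge set of a bowtie: the union of two unbalanced cycles which meet at a single
vertex (and have no edge in common, which excludes the union of a loop with itself), or the union
of two vertex-disjoint unbalanced cycles and a simple path which meets one cycle at each end and
is otherwise disjoint from them. -/
def IsBowtie (G : SignedGraph α β) (B : Set β) : Prop :=
  ∃ W₁ C₁ W₂ C₂, G.graph.IsCycle W₁ C₁ ∧ ¬ G.EvenNeg C₁ ∧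
    G.graph.IsCycle W₂ C₂ ∧ ¬ G.EvenNeg C₂ ∧
    ((Disjoint C₁ C₂ ∧ (∃ x, W₁ ∩ W₂ = {x}) ∧ B = C₁ ∪ C₂) ∨
      (Disjoint W₁ W₂ ∧ ∃ x y W P, G.graph.IsSimplePath x y W P ∧
        W ∩ W₁ = {x} ∧ W ∩ W₂ = {y} ∧ B = C₁ ∪ C₂ ∪ P))

/-- A cutset: a set of edges whose removal increases the number of balanced connected components
if the signed graph is unbalanced, and the number of connected components if it is balanced. -/
def IsCutset (G : SignedGraph α β) (X : Set β) : Prop :=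
  X ⊆ E(G.graph) ∧
    (¬ G.Balanced → G.numBalanced < (G.deleteEdges X).numBalanced) ∧
    (G.Balanced → G.numComponents < (G.deleteEdges X).numComponents)

/-- A cocircuit of a signed graph is a minimal cutset. -/
def IsCocircuit (G : SignedGraph α β) (X : Set β) : Prop :=
  Minimal G.IsCutset X

/-- The `r`-th cogirth `υ_r`: the minimum number of edges whose removal results in a signed graph
with `r` balanced components. -/
noncomputable def cogirth (G : SignedGraph α β) (r : ℕ) : ℕ :=
  sInf {n : ℕ | ∃ X : Set β, X ⊆ E(G.graph) ∧ (G.deleteEdges X).numBalanced = r ∧ X.ncard = n}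

/-- The `r`-th edge connectivity `λ_r`: the minimum number of edges whose removal results in a
signed graph with `r + 1` connected components. -/
noncomputable def edgeConnectivity (G : SignedGraph α β) (r : ℕ) : ℕ :=
  sInf {n : ℕ | ∃ X : Set β, X ⊆ E(G.graph) ∧ (G.deleteEdges X).numComponents = r + 1 ∧
    X.ncard = n}

/-! ### The signed-graphic matroid

The matroid is the one with rank function `ρ(X) = |V| - c₀(X)`, where `c₀(X)` is the number of
balanced components of the signed subgraph with all the vertices and with edge set `X`; thus `I`
is independent if and only if `|I| = |V| - c₀(I)`. The lemmas that follow show that this is a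
matroid, with that rank function, by comparison with the columns of the incidence matrix. -/

/-- Signed walks of length `n`, with the product of the signs. -/
inductive SWalk (G : SignedGraph α β) : ℕ → ℤˣ → α → α → Prop
  | nil (x : α) : SWalk G 0 1 x x
  | cons {n : ℕ} {s : ℤˣ} {x y z : α} {e : β} :
      G.graph.IsLink e x y → SWalk G n s y z → SWalk G (n + 1) (G.sign e * s) x z

theorem SWalk.trans {G : SignedGraph α β} {n m : ℕ} {s t : ℤˣ} {x y z : α}
    (h : G.SWalk n s x y) (h' : G.SWalk m t y z) : G.SWalk (n + m) (s * t) x z := by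
  induction h with
  | nil x => simpa using h'
  | cons hl _ ih =>
    have := SWalk.cons hl (ih h')
    rw [← mul_assoc] at this
    convert this using 1
    omega

theorem SWalk.symm {G : SignedGraph α β} {n : ℕ} {s : ℤˣ} {x y : α}
    (h : G.SWalk n s x y) : G.SWalk n s y x := by
  induction h with
  | nil x => exact SWalk.nil x
  | cons hl _ ih =>
    have := ih.trans (SWalk.cons hl.symm (SWalk.nil _))
    rw [mul_one, mul_comm] at this
    exact this

theorem SWalk.reach {G : SignedGraph α β} {n : ℕ} {s : ℤˣ} {x y : α}
    (h : G.SWalk n s x y) : G.graph.Reach x y := by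
  induction h with
  | nil x => exact Relation.ReflTransGen.refl
  | cons hl _ ih => exact Relation.ReflTransGen.head ⟨_, hl⟩ ih

theorem exists_sWalk {G : SignedGraph α β} {x y : α} (h : G.graph.Reach x y) :
    ∃ n s, G.SWalk n s x y := by
  induction h using Relation.ReflTransGen.head_induction_on with
  | refl => exact ⟨0, 1, SWalk.nil _⟩
  | head h _ ih =>
    obtain ⟨e, he⟩ := h
    obtain ⟨n, s, hs⟩ := ih
    exact ⟨_, _, SWalk.cons he hs⟩

theorem sWalk_of_fun {G : SignedGraph α β} (v : ℕ → α) (e : ℕ → β) (i k : ℕ)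
    (h : ∀ j, i ≤ j → j < i + k → G.graph.IsLink (e j) (v j) (v (j + 1))) :
    G.SWalk k (∏ j ∈ Finset.Ico i (i + k), G.sign (e j)) (v i) (v (i + k)) := by
  induction k with
  | zero => simpa using SWalk.nil (v i)
  | succ k ih =>
    have h1 := ih fun j h1 h2 ↦ h j h1 (by omega)
    have h2 := h1.trans (SWalk.cons (h (i + k) (by omega) (by omega)) (SWalk.nil _))
    rw [← add_assoc, Finset.prod_Ico_succ_top (by omega)]
    simpa using h2

theorem SWalk.exists_fun {G : SignedGraph α β} {n : ℕ} {s : ℤˣ} {x y : α}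
    (h : G.SWalk (n + 1) s x y) : ∃ (v : ℕ → α) (e : ℕ → β), v 0 = x ∧ v (n + 1) = y ∧
      (∀ j, j < n + 1 → G.graph.IsLink (e j) (v j) (v (j + 1))) ∧
      ∏ j ∈ Finset.range (n + 1), G.sign (e j) = s := by
  induction n generalizing s x with
  | zero =>
    cases h with
    | @cons _ s _ y' _ e hl h =>
      cases h
      refine ⟨fun i ↦ if i = 0 then x else y, fun _ ↦ e, by simp, by simp, ?_, by simp⟩
      intro j hj
      obtain rfl : j = 0 := by omega
      simpa using hl
  | succ n ih =>
    cases h with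
    | @cons _ s _ y' _ e hl h =>
      obtain ⟨v, e', h0, hn, hlink, hprod⟩ := ih h
      refine ⟨fun i ↦ Nat.casesOn i x v, fun i ↦ Nat.casesOn i e e', rfl, hn, ?_, ?_⟩
      · rintro (_ | j) hj
        · simpa [h0] using hl
        · exact hlink j (by omega)
      · rw [Finset.prod_range_succ', mul_comm]
        simp [hprod]

theorem prod_sign_eq (G : SignedGraph α β) {n : ℕ} (e : Fin n → β) (he : Function.Injective e) :
    ∏ i, G.sign (e i) = (-1) ^ {f ∈ Set.range e | G.sign f = -1}.ncard := by
  classical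
  have h1 : {f ∈ Set.range e | G.sign f = -1} =
      e '' ((Finset.univ.filter fun i ↦ G.sign (e i) = -1 : Finset (Fin n)) : Set (Fin n)) := by
    ext f
    simp only [Set.mem_ofPred_eq, Set.mem_range, Set.mem_image, Finset.mem_coe, Finset.mem_filter,
      Finset.mem_univ, true_and]
    constructor
    · rintro ⟨⟨i, rfl⟩, h⟩
      exact ⟨i, h, rfl⟩
    · rintro ⟨i, h, rfl⟩
      exact ⟨⟨i, rfl⟩, h⟩
  rw [h1, Set.ncard_image_of_injective _ he, Set.ncard_coe_finset]
  have h2 : ∀ i, G.sign (e i) = if G.sign (e i) = -1 then -1 else 1 := by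
    intro i
    rcases Int.units_eq_one_or (G.sign (e i)) with h | h <;> simp [h]
  rw [Finset.prod_congr rfl fun i _ ↦ h2 i, Finset.prod_ite]
  simp

theorem not_evenNeg_iff (G : SignedGraph α β) {n : ℕ} (e : Fin n → β)
    (he : Function.Injective e) :
    ¬ G.EvenNeg (Set.range e) ↔ ∏ i, G.sign (e i) = -1 := by
  rw [prod_sign_eq G e he, EvenNeg]
  generalize {f ∈ Set.range e | G.sign f = -1}.ncard = k
  rcases Nat.even_or_odd k with h | h
  · simp [h, h.neg_one_pow]
  · simp [h, h.neg_one_pow]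

theorem sWalk_of_isCycle {G : SignedGraph α β} {W : Set α} {C : Set β}
    (h : G.graph.IsCycle W C) (hC : ¬ G.EvenNeg C) : ∃ x ∈ W, ∃ n, G.SWalk n (-1) x x := by
  obtain ⟨n, v, e, -, he, hl, rfl, rfl⟩ := h
  rw [not_evenNeg_iff G e he] at hC
  refine ⟨v 0, ⟨0, rfl⟩, n + 1, ?_⟩
  have hsucc : ∀ j, Fin.ofNat (n + 1) (j + 1) = Fin.ofNat (n + 1) j + 1 := by
    intro j
    ext
    simp [Fin.val_add]
  have h1 := sWalk_of_fun (G := G) (fun i ↦ v (Fin.ofNat (n + 1) i))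
    (fun i ↦ e (Fin.ofNat (n + 1) i)) 0 (n + 1)
    (fun j _ _ ↦ by simpa only [hsucc] using hl (Fin.ofNat (n + 1) j))
  have h2 : ∏ j ∈ Finset.Ico 0 (0 + (n + 1)), G.sign (e (Fin.ofNat (n + 1) j)) = -1 := by
    rw [zero_add, ← Finset.range_eq_Ico,
      ← Fin.prod_univ_eq_prod_range (fun i : ℕ ↦ G.sign (e (Fin.ofNat (n + 1) i))) (n + 1), ← hC]
    simp
  rw [h2] at h1
  have h3 : Fin.ofNat (n + 1) (0 + (n + 1)) = 0 := by
    ext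
    simp
  have h4 : Fin.ofNat (n + 1) 0 = 0 := rfl
  simp only [h3, h4] at h1
  exact h1

theorem exists_isCycle {G : SignedGraph α β} {n : ℕ} {x : α} (h : G.SWalk n (-1) x x) :
    ∃ W C, G.graph.IsCycle W C ∧ ¬ G.EvenNeg C ∧ ∀ w ∈ W, G.graph.Reach x w := by
  induction n using Nat.strong_induction_on generalizing x with
  | _ n ih =>
  rcases n with _ | n
  · generalize hs : (-1 : ℤˣ) = s at h
    cases h
    exact absurd hs (by decide)
  obtain ⟨v, e, h0, hn, hl, hp⟩ := h.exists_fun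
  have hreach : ∀ i, i ≤ n + 1 → G.graph.Reach x (v i) := by
    intro i hi
    have := sWalk_of_fun v e 0 i fun j _ h2 ↦ hl j (by omega)
    rw [h0, zero_add] at this
    exact this.reach
  by_cases hex : ∃ i j, i < j ∧ j ≤ n + 1 ∧ v i = v j ∧ j - i < n + 1
  · obtain ⟨i, j, hij, hj, hv, hlt⟩ := hex
    have h1 := sWalk_of_fun v e 0 i fun k _ h2 ↦ hl k (by omega)
    have h2 := sWalk_of_fun v e i (j - i) fun k _ h2 ↦ hl k (by omega)
    have h3 := sWalk_of_fun v e j (n + 1 - j) fun k _ h2 ↦ hl k (by omega)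
    have e1 : i + (j - i) = j := by omega
    have e2 : j + (n + 1 - j) = n + 1 := by omega
    rw [zero_add, h0] at h1
    rw [e1, ← hv] at h2
    rw [e2, ← hv, hn] at h3
    have hprod : (∏ k ∈ Finset.Ico 0 i, G.sign (e k)) * (∏ k ∈ Finset.Ico i j, G.sign (e k)) *
        (∏ k ∈ Finset.Ico j (n + 1), G.sign (e k)) = -1 := by
      rw [Finset.prod_Ico_consecutive _ (by omega) (by omega),
        Finset.prod_Ico_consecutive _ (by omega) (by omega), ← hp, Finset.range_eq_Ico]
    rcases Int.units_eq_one_or (∏ k ∈ Finset.Ico i j, G.sign (e k)) with hs | hs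
    · rw [hs, mul_one] at hprod
      have h4 := h1.trans h3
      rw [hprod] at h4
      exact ih _ (by omega) h4
    · rw [hs] at h2
      obtain ⟨W, C, hc, hu, hr⟩ := ih _ hlt h2
      exact ⟨W, C, hc, hu, fun w hw ↦ (hreach i (by omega)).trans (hr w hw)⟩
  · push Not at hex
    have hinj : ∀ i j, i < j → j < n + 1 → v i ≠ v j := by
      intro i j h1 h2 h3
      have := hex i j h1 (by omega) h3
      omega
    have heinj : ∀ i j, i < j → j < n + 1 → e i ≠ e j := by
      intro i j h1 h2 h3
      have hi := hl i (by omega)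
      have hj := hl j h2
      rw [h3] at hi
      rcases hi.eq_and_eq_or_eq_and_eq hj with ⟨h4, -⟩ | ⟨h4, h5⟩
      · exact hinj i j h1 h2 h4
      · have h6 := hex i (j + 1) (by omega) (by omega) h4
        have h7 : i + 1 = j := by
          by_contra hne
          exact hinj (i + 1) j (by omega) h2 h5
        obtain rfl : i = 0 := by omega
        obtain rfl : j = 1 := by omega
        obtain rfl : n = 1 := by omega
        rw [Finset.prod_range_succ, Finset.prod_range_one, h3, Int.units_mul_self] at hp
        exact absurd hp (by decide)
    have heF : Function.Injective fun i : Fin (n + 1) ↦ e i := by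
      intro i j hij
      by_contra hne
      rcases lt_or_gt_of_ne (fun h ↦ hne (Fin.ext h) : (i : ℕ) ≠ j) with h | h
      · exact heinj i j h j.2 hij
      · exact heinj j i h i.2 hij.symm
    refine ⟨_, _, ⟨n, fun i ↦ v i, fun i ↦ e i, ?_, heF, ?_, rfl, rfl⟩, ?_, ?_⟩
    · intro i j hij
      by_contra hne
      rcases lt_or_gt_of_ne (fun h ↦ hne (Fin.ext h) : (i : ℕ) ≠ j) with h | h
      · exact hinj i j h j.2 hij
      · exact hinj j i h i.2 hij.symm
    · intro i
      have := hl i i.2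
      by_cases hi : i = Fin.last n
      · subst hi
        simp only [Fin.val_last] at this ⊢
        rw [hn, ← h0] at this
        simpa using this
      · have h1 := Fin.val_add_one_of_lt (lt_of_le_of_ne (Fin.le_last i) hi)
        simpa only [h1] using this
    · rw [not_evenNeg_iff G _ heF, Fin.prod_univ_eq_prod_range (fun i ↦ G.sign (e i)), hp]
    · rintro _ ⟨i, rfl⟩
      exact hreach i (by omega)

/-- The vectors that are orthogonal to all columns of the incidence matrix. -/
def leftKernel (G : SignedGraph α β) : Submodule ℚ (V(G.graph) → ℚ) where
  carrier := {y | ∀ e (x z : V(G.graph)), G.graph.IsLink e x z →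
    y x = ((G.sign e : ℤ) : ℚ) * y z}
  add_mem' {a b} ha hb e x z h := by
    simp only [Pi.add_apply]
    rw [ha e x z h, hb e x z h]
    ring
  zero_mem' e x z h := by simp
  smul_mem' c a ha e x z h := by
    simp only [Pi.smul_apply, smul_eq_mul]
    rw [ha e x z h]
    ring

theorem SWalk.right_mem {G : SignedGraph α β} {n : ℕ} {s : ℤˣ} {x y : α}
    (h : G.SWalk n s x y) (hx : x ∈ V(G.graph)) : y ∈ V(G.graph) := by
  induction h with
  | nil x => exact hx
  | cons hl _ ih => exact ih hl.right_mem

theorem reach_symm {G : SignedGraph α β} {x y : α} (h : G.graph.Reach x y) :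
    G.graph.Reach y x := by
  obtain ⟨n, s, hs⟩ := exists_sWalk h
  exact hs.symm.reach

theorem leftKernel_walk {G : SignedGraph α β} {y : V(G.graph) → ℚ} (hy : y ∈ G.leftKernel)
    {n : ℕ} {s : ℤˣ} {a b : α} (h : G.SWalk n s a b) (ha : a ∈ V(G.graph)) (hb : b ∈ V(G.graph)) :
    y ⟨a, ha⟩ = ((s : ℤ) : ℚ) * y ⟨b, hb⟩ := by
  induction h with
  | nil x => simp
  | @cons n s x z w e hl _ ih =>
    rw [hy e ⟨x, ha⟩ ⟨z, hl.right_mem⟩ hl, ih hl.right_mem hb]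
    push_cast
    ring

theorem eq_of_reach {G : SignedGraph α β} {S : Set α} (hS : S ∈ G.graph.components) {x y : α}
    (hx : x ∈ S) : y ∈ S ↔ G.graph.Reach x y := by
  obtain ⟨w, -, rfl⟩ := hS
  exact ⟨fun h ↦ (reach_symm hx).trans h, fun h ↦ Relation.ReflTransGen.trans hx h⟩

theorem component_subset {G : SignedGraph α β} {S : Set α} (hS : S ∈ G.graph.components) :
    S ⊆ V(G.graph) := by
  obtain ⟨w, hw, rfl⟩ := hS
  intro y hy
  obtain ⟨n, s, hs⟩ := exists_sWalk hy
  exact hs.right_mem hw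

theorem component_eq {G : SignedGraph α β} {S T : Set α} (hS : S ∈ G.graph.components)
    (hT : T ∈ G.graph.components) {x : α} (hxS : x ∈ S) (hxT : x ∈ T) : S = T := by
  ext y
  rw [eq_of_reach hS hxS, eq_of_reach hT hxT]

theorem component_nonempty {G : SignedGraph α β} {S : Set α} (hS : S ∈ G.graph.components) :
    S.Nonempty := by
  obtain ⟨w, -, rfl⟩ := hS
  exact ⟨w, Relation.ReflTransGen.refl⟩

theorem finite_components (G : SignedGraph α β) : G.graph.components.Finite :=
  (G.finite_vertexSet.finite_subsets).subset fun _ hS ↦ component_subset hS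

/-- In a balanced component all walks between two vertices have the same sign. -/
theorem sign_unique {G : SignedGraph α β} {S : Set α} (hS : S ∈ G.balancedComponents)
    {x y : α} (hx : x ∈ S) {n m : ℕ} {s t : ℤˣ} (h : G.SWalk n s x y) (h' : G.SWalk m t x y) :
    s = t := by
  by_contra hne
  have h1 := h.trans h'.symm
  have h2 : s * t = -1 := by
    rcases Int.units_eq_one_or s with rfl | rfl <;> rcases Int.units_eq_one_or t with rfl | rfl <;>
      simp_all
  rw [h2] at h1
  obtain ⟨W, C, hc, hu, hr⟩ := exists_isCycle h1
  exact hu (hS.2 W C hc fun w hw ↦ (eq_of_reach hS.1 hx).2 (hr w hw))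

theorem leftKernel_eq_zero {G : SignedGraph α β} {y : V(G.graph) → ℚ} (hy : y ∈ G.leftKernel)
    {S : Set α} (hS : S ∈ G.graph.components) (hS' : S ∉ G.balancedComponents)
    (x : V(G.graph)) (hx : (x : α) ∈ S) : y x = 0 := by
  have h1 : ∃ W C, G.graph.IsCycle W C ∧ W ⊆ S ∧ ¬ G.EvenNeg C := by
    by_contra hcon
    push Not at hcon
    exact hS' ⟨hS, hcon⟩
  obtain ⟨W, C, hc, hW, hu⟩ := h1
  obtain ⟨w, hw, n, hn⟩ := sWalk_of_isCycle hc hu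
  have hwV := component_subset hS (hW hw)
  have h2 := leftKernel_walk hy hn hwV hwV
  obtain ⟨m, s, hm⟩ := exists_sWalk ((eq_of_reach hS hx).1 (hW hw))
  have h3 := leftKernel_walk hy hm x.2 hwV
  have h4 : y ⟨w, hwV⟩ = 0 := by
    push_cast at h2
    linarith
  rw [h4, mul_zero] at h3
  exact h3

/-- A vertex in each balanced component. -/
noncomputable def base (G : SignedGraph α β) (S : G.balancedComponents) : V(G.graph) :=
  ⟨(component_nonempty S.2.1).choose, component_subset S.2.1 (component_nonempty S.2.1).choose_spec⟩

theorem base_mem (G : SignedGraph α β) (S : G.balancedComponents) : (G.base S : α) ∈ S.1 :=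
  (component_nonempty S.2.1).choose_spec

theorem finrank_leftKernel (G : SignedGraph α β) :
    Module.finrank ℚ G.leftKernel = G.numBalanced := by
  classical
  have hfin : Finite G.balancedComponents :=
    (G.finite_components.subset fun S hS ↦ hS.1).to_subtype
  have : Fintype G.balancedComponents := Fintype.ofFinite _
  let f : G.leftKernel →ₗ[ℚ] (G.balancedComponents → ℚ) :=
    { toFun := fun y S ↦ y.1 (G.base S)
      map_add' := fun _ _ ↦ rfl
      map_smul' := fun _ _ ↦ rfl }
  have hinj : Function.Injective f := by
    rw [injective_iff_map_eq_zero]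
    intro y hy
    ext x
    have hS : {z | G.graph.Reach x z} ∈ G.graph.components := ⟨x, x.2, rfl⟩
    have hxS : (x : α) ∈ {z | G.graph.Reach x z} := Relation.ReflTransGen.refl
    by_cases hb : {z | G.graph.Reach x z} ∈ G.balancedComponents
    · obtain ⟨n, s, hs⟩ := exists_sWalk
        ((eq_of_reach hS hxS).1 (G.base_mem ⟨_, hb⟩))
      have h1 := leftKernel_walk y.2 hs x.2 (G.base ⟨_, hb⟩).2
      have h2 : y.1 (G.base ⟨_, hb⟩) = 0 := congrFun hy ⟨_, hb⟩
      change y.1 x = _ * y.1 (G.base ⟨_, hb⟩) at h1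
      rw [h1, h2, mul_zero]
      rfl
    · exact leftKernel_eq_zero y.2 hS hb x hxS
  have hsurj : Function.Surjective f := by
    intro g
    let P : V(G.graph) → ℚ → Prop := fun x q ↦
      (∃ (S : G.balancedComponents) (n : ℕ) (s : ℤˣ), (x : α) ∈ S.1 ∧
        G.SWalk n s x (G.base S) ∧ q = ((s : ℤ) : ℚ) * g S) ∨
      ((∀ S : G.balancedComponents, (x : α) ∉ S.1) ∧ q = 0)
    have hP : ∀ x, ∃ q, P x q := by
      intro x
      by_cases h : ∃ S : G.balancedComponents, (x : α) ∈ S.1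
      · obtain ⟨S, hS⟩ := h
        obtain ⟨n, s, hs⟩ := exists_sWalk ((eq_of_reach S.2.1 hS).1 (G.base_mem S))
        exact ⟨_, Or.inl ⟨S, n, s, hS, hs, rfl⟩⟩
      · push Not at h
        exact ⟨0, Or.inr ⟨h, rfl⟩⟩
    choose y hy using hP
    have hval : ∀ (S : G.balancedComponents) (x : V(G.graph)) (n : ℕ) (s : ℤˣ), (x : α) ∈ S.1 →
        G.SWalk n s x (G.base S) → y x = ((s : ℤ) : ℚ) * g S := by
      intro S x n s hx hs
      rcases hy x with ⟨T, m, t, hxT, ht, hq⟩ | ⟨h, -⟩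
      · obtain rfl : S = T := Subtype.ext (component_eq S.2.1 T.2.1 hx hxT)
        rw [hq, sign_unique S.2 hx hs ht]
      · exact absurd hx (h S)
    have hker : y ∈ G.leftKernel := by
      intro e x z hl
      rcases hy z with ⟨S, m, t, hz, ht, hq⟩ | ⟨h, hq⟩
      · have hx : (x : α) ∈ S.1 := (eq_of_reach S.2.1 hz).2
          (Relation.ReflTransGen.single ⟨e, hl.symm⟩)
        rw [hval S x _ _ hx (SWalk.cons hl ht), hq]
        push_cast
        ring
      · rcases hy x with ⟨S, m, t, hx, ht, -⟩ | ⟨-, hq'⟩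
        · exact absurd ((eq_of_reach S.2.1 hx).2
            (Relation.ReflTransGen.single ⟨e, hl⟩)) (h S)
        · rw [hq, hq', mul_zero]
    refine ⟨⟨y, hker⟩, ?_⟩
    ext S
    change y (G.base S) = g S
    rw [hval S (G.base S) 0 1 (G.base_mem S) (SWalk.nil _)]
    simp
  rw [(LinearEquiv.ofBijective f ⟨hinj, hsurj⟩).finrank_eq, Module.finrank_fintype_fun_eq_card,
    numBalanced, ← Nat.card_coe_set_eq, Nat.card_eq_fintype_card]

open Classical in
/-- The columns of the incidence matrix over the rational numbers. -/
noncomputable def column (G : SignedGraph α β) (e : β) : V(G.graph) → ℚ :=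
  if h : ∃ p : V(G.graph) × V(G.graph), G.graph.IsLink e p.1 p.2 then
    Pi.single h.choose.1 1 - ((G.sign e : ℤ) : ℚ) • Pi.single h.choose.2 1
  else 0

theorem sign_mul_self (G : SignedGraph α β) (e : β) :
    ((G.sign e : ℤ) : ℚ) * ((G.sign e : ℤ) : ℚ) = 1 := by
  rcases Int.units_eq_one_or (G.sign e) with h | h <;> simp [h]

theorem column_dotProduct (G : SignedGraph α β) [Fintype V(G.graph)] (y : V(G.graph) → ℚ)
    {e : β} (he : e ∈ E(G.graph)) : G.column e ⬝ᵥ y = 0 ↔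
      ∀ x z : V(G.graph), G.graph.IsLink e x z → y x = ((G.sign e : ℤ) : ℚ) * y z := by
  classical
  have h : ∃ p : V(G.graph) × V(G.graph), G.graph.IsLink e p.1 p.2 := by
    obtain ⟨x, z, hl⟩ := G.graph.exists_isLink_of_mem_edgeSet he
    exact ⟨⟨⟨x, hl.left_mem⟩, ⟨z, hl.right_mem⟩⟩, hl⟩
  have hs := G.sign_mul_self e
  have h1 : G.column e ⬝ᵥ y = y h.choose.1 - ((G.sign e : ℤ) : ℚ) * y h.choose.2 := by
    rw [column, dif_pos h, sub_dotProduct, smul_dotProduct, single_dotProduct, single_dotProduct]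
    simp
  rw [h1]
  constructor
  · intro h2 x z hl
    rcases h.choose_spec.eq_and_eq_or_eq_and_eq hl with ⟨h3, h4⟩ | ⟨h3, h4⟩
    · rw [← Subtype.ext h3, ← Subtype.ext h4]
      linarith
    · rw [← Subtype.ext h3, ← Subtype.ext h4, sub_eq_zero.1 h2, ← mul_assoc, hs, one_mul]
  · intro h2
    rw [h2 _ _ h.choose_spec, sub_self]

theorem finrank_span_column (G : SignedGraph α β) {X : Set β} (hX : X ⊆ E(G.graph)) :
    Module.finrank ℚ (Submodule.span ℚ (G.column '' X)) + (G.restrict X).numBalanced =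
      V(G.graph).ncard := by
  classical
  have : Fintype V(G.graph) := G.finite_vertexSet.fintype
  have : Fintype X := (G.finite_edgeSet.subset hX).fintype
  let A : Matrix X V(G.graph) ℚ := fun e ↦ G.column e
  have h1 : LinearMap.ker A.mulVecLin = (G.restrict X).leftKernel := by
    ext y
    rw [LinearMap.mem_ker, Matrix.mulVecLin_apply, funext_iff]
    constructor
    · intro h e x z hl
      exact (G.column_dotProduct y (hX hl.1)).1 (h ⟨e, hl.1⟩) x z hl.2
    · intro h e
      exact (G.column_dotProduct y (hX e.2)).2 fun x z hl ↦ h e x z ⟨e.2, hl⟩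
  have h2 := A.mulVecLin.finrank_range_add_finrank_ker
  have h5 : Module.finrank ℚ (LinearMap.ker A.mulVecLin) = (G.restrict X).numBalanced :=
    (congrArg (fun p : Submodule ℚ (V(G.graph) → ℚ) ↦ Module.finrank ℚ p) h1).trans
      (finrank_leftKernel (G.restrict X))
  rw [h5, Module.finrank_fintype_fun_eq_card] at h2
  have h3 : Module.finrank ℚ (LinearMap.range A.mulVecLin) =
      Module.finrank ℚ (Submodule.span ℚ (G.column '' X)) := by
    have := A.rank_eq_finrank_span_row
    rw [Matrix.rank] at this
    have h4 : Set.range A.row = G.column '' X := by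
      ext w
      constructor
      · rintro ⟨e, rfl⟩
        exact ⟨e, e.2, rfl⟩
      · rintro ⟨e, he, rfl⟩
        exact ⟨⟨e, he⟩, rfl⟩
    rw [this, h4]
  rw [← h3, h2, ← Nat.card_eq_fintype_card, Nat.card_coe_set_eq]

/-- Independence in the signed-graphic matroid: `|I| = |V| - c₀(I)`. -/
def Indep (G : SignedGraph α β) (I : Set β) : Prop :=
  I ⊆ E(G.graph) ∧ I.ncard + (G.restrict I).numBalanced = V(G.graph).ncard

theorem indep_iff (G : SignedGraph α β) (I : Set β) :
    G.Indep I ↔ I ⊆ E(G.graph) ∧ LinearIndepOn ℚ G.column I := by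
  refine and_congr_right fun hI ↦ ?_
  have : Fintype I := (G.finite_edgeSet.subset hI).fintype
  have h1 := G.finrank_span_column hI
  rw [LinearIndepOn, linearIndependent_iff_card_eq_finrank_span, Set.finrank,
    ← Set.image_eq_range, ← Nat.card_eq_fintype_card, Nat.card_coe_set_eq]
  omega

theorem indep_aug (G : SignedGraph α β) {I J : Set β} (hI : G.Indep I) (hJ : G.Indep J)
    (h : I.ncard < J.ncard) : ∃ e ∈ J, e ∉ I ∧ G.Indep (insert e I) := by
  have : Fintype V(G.graph) := G.finite_vertexSet.fintype
  have h1 : ∃ e ∈ J, G.column e ∉ Submodule.span ℚ (G.column '' I) := by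
    by_contra hcon
    push Not at hcon
    have h2 : Submodule.span ℚ (G.column '' J) ≤ Submodule.span ℚ (G.column '' I) := by
      rw [Submodule.span_le]
      rintro _ ⟨e, he, rfl⟩
      exact hcon e he
    have h3 := Submodule.finrank_mono h2
    have h4 := G.finrank_span_column hI.1
    have h5 := G.finrank_span_column hJ.1
    have h6 := hI.2
    have h7 := hJ.2
    omega
  obtain ⟨e, he, hn⟩ := h1
  refine ⟨e, he, fun heI ↦ hn (Submodule.subset_span ⟨e, heI, rfl⟩), ?_⟩
  rw [indep_iff] at hI ⊢
  exact ⟨Set.insert_subset (hJ.1 he) hI.1, hI.2.insert hn⟩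

/-- The signed-graphic matroid of a signed graph. Its ground set is the edge set, and a set `I` of
edges is independent if and only if `|I| = |V| - c₀(I)`. -/
noncomputable def matroid (G : SignedGraph α β) : Matroid β :=
  (IndepMatroid.ofFinite G.finite_edgeSet G.Indep
    ((G.indep_iff ∅).2 ⟨Set.empty_subset _, linearIndepOn_empty ℚ _⟩)
    (fun I J hJ hIJ ↦ by
      rw [indep_iff] at hJ ⊢
      exact ⟨hIJ.trans hJ.1, hJ.2.mono hIJ⟩)
    (fun _ _ hI hJ h ↦ G.indep_aug hI hJ h)
    (fun _ hI ↦ hI.1)).matroid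

theorem matroid_indep_iff (G : SignedGraph α β) (I : Set β) : G.matroid.Indep I ↔ G.Indep I :=
  Iff.rfl

/-- The rank function of the signed-graphic matroid is `ρ(X) = |V| - c₀(X)`. -/
theorem rkNat_matroid (G : SignedGraph α β) {X : Set β} (hX : X ⊆ E(G.graph)) :
    G.matroid.rkNat X + (G.restrict X).numBalanced = V(G.graph).ncard := by
  obtain ⟨I, hI⟩ := G.matroid.exists_isBasis X hX
  have hI1 : G.Indep I := hI.indep
  have hli := ((G.indep_iff I).1 hI1).2
  have hspan : Submodule.span ℚ (G.column '' X) = Submodule.span ℚ (G.column '' I) := by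
    refine le_antisymm ?_ (Submodule.span_mono (Set.image_mono hI.subset))
    rw [Submodule.span_le]
    rintro _ ⟨e, he, rfl⟩
    by_contra hn
    have h1 : G.matroid.Indep (insert e I) :=
      (G.indep_iff _).2 ⟨Set.insert_subset (hX he) hI1.1, hli.insert hn⟩
    have h2 := hI.eq_of_subset_indep h1 (Set.subset_insert e I)
      (Set.insert_subset he hI.subset)
    exact hn (Submodule.subset_span ⟨e, h2 ▸ Set.mem_insert e I, rfl⟩)
  have h1 := G.finrank_span_column hX
  have h2 := G.finrank_span_column hI1.1
  have h3 := hI1.2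
  have h4 : G.matroid.rkNat X = I.ncard := by
    rw [Matroid.rkNat, ← hI.encard_eq_eRk, Set.ncard]
  rw [hspan] at h1
  omega

end SignedGraph

/-! ### Nullity, non-redundant unions and generalized Hamming weights of a finite matroid. -/

namespace Matroid

variable {β : Type*}

/-! Parts (i) and (iii) are instances of one fact on finite matroids,
`Matroid.isLeast_genHammingWeight`. Let `p` be a class of sets that contains all circuits and whose
members have no coloops (each element is spanned by the others). Then `d_r` is the least size of a
union of `r` non-redundant members. In one direction, take a smallest `X` of nullity `r` with basis
`I`: the `r` elements of `X \ I` have fundamental circuits in `X`, and each of these elements lies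
in its own circuit only. In the other direction, each of `r` non-redundant members has a private
element; deleting all the private elements does not change the span of the union, so its nullity is
at least `r`.

For the dual, `nullityNat_dual_matroid` says that the nullity of `X` in `M*` is the number of
balanced components gained by deleting `X`. A connected signed graph has no balanced component if it
is unbalanced; if it is balanced, it has one component, and after any deletion balanced components
and components are the same. This gives (ii). It also identifies cutsets with dependent sets of `M*`
and cocircuits with circuits of `M*`, which gives (iii).

For (i), the closure is described by potentials, the functions on vertices orthogonal to incidence
columns: `e` is in the closure of `X` iff every potential of `X` is one of `e` (`mem_closure_iff`).
A potential is carried along a path by the sign of the path and vanishes on unbalanced cycles; hence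
balanced cycles and bowties have no coloops.

Conversely, let `C` be a circuit without a balanced cycle. If `e` is in `C`, the component of an end
of `e` in `C \ {e}` contains an unbalanced cycle (`exists_unbalanced_cycle`). Use this once to get
an unbalanced cycle, and again with `e` on that cycle. Either the two cycles form a bowtie, joined
by a path if they are disjoint, or they meet in several vertices and their union contains a balanced
cycle (`exists_balanced_of_nontrivial`), which is excluded. The bowtie is dependent, so it is all of
`C`. -/

theorem IsBasis.ncard_eq_rkNat {N : Matroid β} {I X : Set β} (hI : N.IsBasis I X) :
    I.ncard = N.rkNat X := by
  rw [rkNat, ← hI.encard_eq_eRk, Set.ncard]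

theorem IsBasis.nullityNat_eq {N : Matroid β} {I X : Set β} (hI : N.IsBasis I X)
    (hX : X.Finite) : N.nullityNat X = (X \ I).ncard := by
  rw [nullityNat, ← hI.ncard_eq_rkNat, Set.ncard_sdiff hI.subset (hX.subset hI.subset)]

/-- The nullity takes all values from `0` to `η(X)` on the subsets of `X`. -/
theorem exists_subset_nullityNat_eq {N : Matroid β} {X : Set β} (hXE : X ⊆ N.E) (hX : X.Finite)
    {r : ℕ} (hr : r ≤ N.nullityNat X) : ∃ Y ⊆ X, N.nullityNat Y = r := by
  obtain ⟨I, hI⟩ := N.exists_isBasis X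
  rw [hI.nullityNat_eq hX] at hr
  -- A basis `I` of `X` together with `r` elements of `X \ I` has nullity `r`, as `I` is still a
  -- basis of it.
  obtain ⟨J, hJ, hJr⟩ := Set.exists_subset_card_eq hr
  have hsub : I ∪ J ⊆ X := Set.union_subset hI.subset (hJ.trans Set.sdiff_subset)
  refine ⟨I ∪ J, hsub, ?_⟩
  have hI' : N.IsBasis I (I ∪ J) := hI.isBasis_subset Set.subset_union_left hsub
  rw [hI'.nullityNat_eq (hX.subset hsub), ← hJr]
  congr 1
  ext x
  constructor
  · rintro ⟨h | h, h'⟩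
    · exact absurd h h'
    · exact h
  · exact fun h ↦ ⟨Or.inr h, (hJ h).2⟩

/-- A union of `r` non-redundant sets without coloops has nullity at least `r`. -/
theorem le_nullityNat_iUnion {N : Matroid β} (hN : N.E.Finite) {r : ℕ} {C : Fin r → Set β}
    (hCE : ∀ i, C i ⊆ N.E) (hC : ∀ i, ∀ e ∈ C i, e ∈ N.closure (C i \ {e}))
    (hnr : NonRedundant C) : r ≤ N.nullityNat (⋃ i, C i) := by
  -- Non-redundancy gives each set a private element.
  have hpriv : ∀ j, ∃ e ∈ C j, ∀ i, e ∈ C i → i = j := by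
    intro j
    obtain ⟨e, he, hne⟩ := Set.exists_of_ssubset (hnr j)
    have h1 : ∀ i, e ∈ C i → i = j := by
      intro i hi
      by_contra hij
      exact hne (Set.mem_biUnion (show i ∈ {i | i ≠ j} from hij) hi)
    obtain ⟨i, hi⟩ := Set.mem_iUnion.1 he
    exact ⟨e, h1 i hi ▸ hi, h1⟩
  choose e he huniq using hpriv
  have hinj : Function.Injective e := fun i j hij ↦ huniq j i (hij ▸ he i)
  have hUE : (⋃ i, C i) ⊆ N.E := Set.iUnion_subset hCE
  have hJU : Set.range e ⊆ ⋃ i, C i := by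
    rintro _ ⟨i, rfl⟩
    exact Set.mem_iUnion_of_mem i (he i)
  -- The private element of `C j` is spanned by the rest of `C j`, which contains no other private
  -- element; so all of them can be dropped at once.
  have hcl : (⋃ i, C i) ⊆ N.closure ((⋃ i, C i) \ Set.range e) := by
    intro x hx
    by_cases hxe : x ∈ Set.range e
    · obtain ⟨j, rfl⟩ := hxe
      refine N.closure_subset_closure ?_ (hC j _ (he j))
      rintro y ⟨hy, hyne⟩
      refine ⟨Set.mem_iUnion_of_mem j hy, ?_⟩
      rintro ⟨k, rfl⟩
      exact hyne (by rw [Set.mem_singleton_iff, huniq k j hy])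
    · exact N.mem_closure_of_mem ⟨hx, hxe⟩ (Set.sdiff_subset.trans hUE)
  obtain ⟨I, hI⟩ := N.exists_isBasis ((⋃ i, C i) \ Set.range e) (Set.sdiff_subset.trans hUE)
  have hI' : N.IsBasis I (⋃ i, C i) := by
    refine hI.indep.isBasis_of_subset_of_subset_closure (hI.subset.trans Set.sdiff_subset) ?_
    rwa [hI.closure_eq_closure]
  rw [hI'.nullityNat_eq (hN.subset hUE)]
  have hsub : Set.range e ⊆ (⋃ i, C i) \ I := fun x hx ↦ ⟨hJU hx, fun hxI ↦ (hI.subset hxI).2 hx⟩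
  calc r = (Set.range e).ncard := by
        rw [← Set.image_univ, Set.ncard_image_of_injective _ hinj, Set.ncard_univ, Nat.card_fin]
    _ ≤ _ := Set.ncard_le_ncard hsub ((hN.subset hUE).subset Set.sdiff_subset)

/-- The sets without coloops in a class that contains all circuits determine the generalized
Hamming weights, by their non-redundant unions. -/
theorem isLeast_genHammingWeight {N : Matroid β} (hN : N.E.Finite) {p : Set β → Prop}
    (hp : ∀ C, N.IsCircuit C → p C) (hpE : ∀ C, p C → C ⊆ N.E)
    (hpcl : ∀ C, p C → ∀ e ∈ C, e ∈ N.closure (C \ {e})) {r : ℕ} (hr : r ≤ N.nullityNat N.E) :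
    IsLeast {n : ℕ | ∃ C : Fin r → Set β, (∀ i, p (C i)) ∧ NonRedundant C ∧
      (⋃ i, C i).ncard = n} (N.genHammingWeight r) := by
  -- The union may have nullity above `r`, but weights refer to nullity exactly `r`; pass to a
  -- subset.
  have hlow : ∀ C : Fin r → Set β, (∀ i, p (C i)) → NonRedundant C →
      ∃ Y ⊆ ⋃ i, C i, Y ⊆ N.E ∧ N.nullityNat Y = r := by
    intro C hC hnr
    have hUE : (⋃ i, C i) ⊆ N.E := Set.iUnion_subset fun i ↦ hpE _ (hC i)
    obtain ⟨Y, hY, hYr⟩ := exists_subset_nullityNat_eq hUE (hN.subset hUE)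
      (le_nullityNat_iUnion hN (fun i ↦ hpE _ (hC i)) (fun i ↦ hpcl _ (hC i)) hnr)
    exact ⟨Y, hY, hY.trans hUE, hYr⟩
  refine ⟨?_, ?_⟩
  -- `Y` shows that the infimum is over a nonempty set, so it is attained by some `X` and is not the
  -- default value `0`.
  · obtain ⟨Y, hYE, hYr⟩ := exists_subset_nullityNat_eq (N := N) subset_rfl hN hr
    obtain ⟨X, hXE, hXr, hXd⟩ := Nat.sInf_mem (s := {n : ℕ | ∃ X : Set β, X ⊆ N.E ∧
      N.nullityNat X = r ∧ X.ncard = n}) ⟨_, Y, hYE, hYr, rfl⟩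
    have hXfin := hN.subset hXE
    obtain ⟨I, hI⟩ := N.exists_isBasis X
    have hcard : (X \ I).ncard = r := by rw [← hI.nullityNat_eq hXfin, hXr]
    have : Finite ↥(X \ I) := (hXfin.subset Set.sdiff_subset).to_subtype
    let f : Fin r ≃ ↥(X \ I) := (Finite.equivFinOfCardEq hcard).symm
    have hfI : ∀ i, (f i : β) ∉ I := fun i ↦ (f i).2.2
    have hcirc : ∀ i, N.IsCircuit (N.fundCircuit (f i) I) := fun i ↦
      hI.indep.fundCircuit_isCircuit (hI.subset_closure (f i).2.1) (hfI i)
    -- Outside `I`, the `i`-th fundamental circuit contains only `f i`.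
    have hnr : NonRedundant fun i ↦ N.fundCircuit (f i) I := by
      intro j
      refine Set.ssubset_iff_exists.2 ⟨Set.iUnion₂_subset fun i _ ↦
        Set.subset_iUnion (fun i ↦ N.fundCircuit (f i) I) i, f j,
        Set.mem_iUnion_of_mem j (N.mem_fundCircuit _ _), ?_⟩
      intro hj
      obtain ⟨i, hij, hi⟩ := Set.mem_iUnion₂.1 hj
      rcases N.fundCircuit_subset_insert _ _ hi with h | h
      · exact hij (f.injective (Subtype.ext h)).symm
      · exact hfI j h
    refine ⟨_, fun i ↦ hp _ (hcirc i), hnr, ?_⟩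
    have hsub : (⋃ i, N.fundCircuit (f i) I) ⊆ X := by
      refine Set.iUnion_subset fun i ↦ (N.fundCircuit_subset_insert _ _).trans ?_
      exact Set.insert_subset (f i).2.1 hI.subset
    -- Squeeze: `d_r ≤ |Z| ≤ |⋃| ≤ |X| = d_r`.
    obtain ⟨Z, hZU, hZE, hZr⟩ := hlow _ (fun i ↦ hp _ (hcirc i)) hnr
    have h1 : N.genHammingWeight r ≤ Z.ncard := Nat.sInf_le ⟨Z, hZE, hZr, rfl⟩
    have h2 := Set.ncard_le_ncard hZU (hXfin.subset hsub)
    have h3 := Set.ncard_le_ncard hsub hXfin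
    have h4 : X.ncard = N.genHammingWeight r := hXd
    omega
  · rintro n ⟨C, hC, hnr, rfl⟩
    obtain ⟨Z, hZU, hZE, hZr⟩ := hlow C hC hnr
    exact (Nat.sInf_le ⟨Z, hZE, hZr, rfl⟩ : N.genHammingWeight r ≤ Z.ncard).trans
      (Set.ncard_le_ncard hZU (hN.subset (Set.iUnion_subset fun i ↦ hpE _ (hC i))))

/-- This is the dual rank formula `ρ*(X) + ρ(E) = ρ(E \ X) + |X|`; finiteness allows it to be read
in `ℕ`, and `ρ*(X) ≤ |X|` makes the subtraction exact. -/
theorem nullityNat_dual {N : Matroid β} (hN : N.E.Finite) {X : Set β} (hX : X ⊆ N.E) :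
    N✶.nullityNat X + N.rkNat (N.E \ X) = N.rkNat N.E := by
  have h := N.eRk_dual_add_eRank X hX
  have hfin : ∀ (N' : Matroid β) (Y : Set β), Y.Finite → N'.eRk Y ≠ ⊤ := fun N' Y hY ↦
    ((N'.eRk_le_encard Y).trans_lt hY.encard_lt_top).ne
  have hXf := hN.subset hX
  have h1 := congrArg ENat.toNat h
  rw [← N.eRk_ground, ENat.toNat_add (hfin _ _ hXf) (hfin _ _ hN),
    ENat.toNat_add (hfin _ _ (hN.subset Set.sdiff_subset)) hXf.encard_lt_top.ne] at h1
  have h2 : N✶.rkNat X ≤ X.ncard :=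
    ENat.toNat_le_toNat (N✶.eRk_le_encard X) hXf.encard_lt_top.ne
  have h3 : X.encard.toNat = X.ncard := rfl
  rw [nullityNat]
  simp only [rkNat] at *
  omega

theorem dep_iff_nullityNat_pos {N : Matroid β} (hN : N.E.Finite) {X : Set β} :
    N.Dep X ↔ X ⊆ N.E ∧ 0 < N.nullityNat X := by
  rw [Dep, and_comm]
  refine and_congr_right fun hX ↦ ?_
  have hXf := hN.subset hX
  obtain ⟨I, hI⟩ := N.exists_isBasis X
  rw [hI.nullityNat_eq hXf, Set.ncard_pos (hXf.subset Set.sdiff_subset), Set.sdiff_nonempty,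
    ← not_iff_not, not_not, not_not]
  exact ⟨fun h ↦ (hI.eq_of_subset_indep h hI.subset subset_rfl).symm.subset, fun h ↦ hI.indep.subset h⟩

end Matroid

/-! ### Cycles as sets of vertices and edges. -/

namespace Graph

variable {α β : Type*}

theorem IsCycle.subset_vertexSet {G : Graph α β} {W : Set α} {C : Set β} (h : G.IsCycle W C) :
    W ⊆ V(G) := by
  obtain ⟨n, v, e, -, -, hl, rfl, -⟩ := h
  rintro _ ⟨i, rfl⟩
  exact (hl i).left_mem

theorem IsCycle.subset_edgeSet {G : Graph α β} {W : Set α} {C : Set β} (h : G.IsCycle W C) :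
    C ⊆ E(G) := by
  obtain ⟨n, v, e, -, -, hl, -, rfl⟩ := h
  rintro _ ⟨i, rfl⟩
  exact (hl i).edge_mem

theorem IsCycle.nonempty {G : Graph α β} {W : Set α} {C : Set β} (h : G.IsCycle W C) :
    C.Nonempty := by
  obtain ⟨n, v, e, -, -, hl, -, rfl⟩ := h
  exact Set.range_nonempty e

theorem isCycle_restrict {G : Graph α β} {X : Set β} {W : Set α} {C : Set β} :
    (G.restrict X).IsCycle W C ↔ G.IsCycle W C ∧ C ⊆ X := by
  constructor
  · rintro ⟨n, v, e, hv, he, hl, rfl, rfl⟩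
    exact ⟨⟨n, v, e, hv, he, fun i ↦ (hl i).2, rfl, rfl⟩, Set.range_subset_iff.2 fun i ↦ (hl i).1⟩
  · rintro ⟨⟨n, v, e, hv, he, hl, rfl, rfl⟩, hX⟩
    exact ⟨n, v, e, hv, he, fun i ↦ ⟨hX ⟨i, rfl⟩, hl i⟩, rfl, rfl⟩

end Graph

/-! ### The dual matroid: cogirth, edge connectivity and cocircuits. -/

namespace SignedGraph

variable {α β : Type*}

theorem restrict_sdiff_eq_deleteEdges (G : SignedGraph α β) (X : Set β) :
    G.restrict (E(G.graph) \ X) = G.deleteEdges X := by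
  simp only [restrict, deleteEdges, Graph.restrict_edgeSet_sdiff_eq_deleteEdges]

theorem restrict_edgeSet (G : SignedGraph α β) : G.restrict E(G.graph) = G := by
  simp only [restrict, Graph.restrict_self]

theorem Balanced.restrict {G : SignedGraph α β} (h : G.Balanced) (X : Set β) :
    (G.restrict X).Balanced :=
  fun W C hC ↦ h W C (Graph.isCycle_restrict.1 hC).1

theorem Balanced.numBalanced_eq {G : SignedGraph α β} (h : G.Balanced) :
    G.numBalanced = G.numComponents := by
  rw [numBalanced, numComponents]
  congr 1
  ext S
  exact ⟨fun hS ↦ hS.1, fun hS ↦ ⟨hS, fun W C hC _ ↦ h W C hC⟩⟩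

theorem Connected.components_eq {G : SignedGraph α β} (hG : G.Connected) :
    G.graph.components = {V(G.graph)} := by
  have h : ∀ x ∈ V(G.graph), {y | G.graph.Reach x y} = V(G.graph) := fun x hx ↦
    (component_subset ⟨x, hx, rfl⟩).antisymm fun y hy ↦ hG.2 x hx y hy
  ext S
  constructor
  · rintro ⟨x, hx, rfl⟩
    exact h x hx
  · rintro rfl
    obtain ⟨x, hx⟩ := hG.1
    exact ⟨x, hx, (h x hx).symm⟩

theorem Connected.numComponents_eq {G : SignedGraph α β} (hG : G.Connected) :
    G.numComponents = 1 := by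
  rw [numComponents, hG.components_eq, Set.ncard_singleton]

theorem Connected.numBalanced_eq_zero {G : SignedGraph α β} (hG : G.Connected)
    (hb : ¬ G.Balanced) : G.numBalanced = 0 := by
  rw [numBalanced, Set.ncard_eq_zero (G.finite_components.subset fun S hS ↦ hS.1)]
  refine Set.eq_empty_of_forall_notMem fun S hS ↦ hb fun W C hC ↦ hS.2 W C hC ?_
  have h := hS.1
  rw [hG.components_eq] at h
  exact h.symm ▸ hC.subset_vertexSet

/-- The rank formula for `E` and for `E \ X` turns the drop in rank into a gain in balanced
components, since `|V|` cancels. -/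
theorem nullityNat_dual_matroid (G : SignedGraph α β) {X : Set β} (hX : X ⊆ E(G.graph)) :
    G.matroid✶.nullityNat X + G.numBalanced = (G.deleteEdges X).numBalanced := by
  have h1 := Matroid.nullityNat_dual (N := G.matroid) G.finite_edgeSet hX
  have h2 := G.rkNat_matroid (X := E(G.graph) \ X) Set.sdiff_subset
  have h3 := G.rkNat_matroid (X := E(G.graph)) subset_rfl
  rw [restrict_sdiff_eq_deleteEdges] at h2
  rw [restrict_edgeSet] at h3
  have h4 : G.matroid.E = E(G.graph) := rfl
  rw [h4] at h1
  omega

/-- Translates the range `r ≤ ρ(M)` into the range of nullities of `M*`. -/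
theorem nullityNat_dual_matroid_ground (G : SignedGraph α β) :
    G.matroid✶.nullityNat G.matroid✶.E = G.matroid.rkNat G.matroid.E := by
  have h := Matroid.nullityNat_dual (N := G.matroid) G.finite_edgeSet subset_rfl
  have h0 : G.matroid.rkNat (G.matroid.E \ G.matroid.E) = 0 := by
    simp [Matroid.rkNat]
  rw [h0] at h
  exact h

/-- Dependent means of positive nullity, that is, deletion gains a balanced component. In the
balanced case every component is balanced before and after the deletion, so the same inequality
counts components. -/
theorem isCutset_iff (G : SignedGraph α β) (X : Set β) :
    G.IsCutset X ↔ G.matroid✶.Dep X := by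
  have hE : G.matroid✶.E = E(G.graph) := rfl
  rw [Matroid.dep_iff_nullityNat_pos (N := G.matroid✶) G.finite_edgeSet, hE, IsCutset]
  refine and_congr_right fun hX ↦ ?_
  have h := G.nullityNat_dual_matroid hX
  by_cases hb : G.Balanced
  · have h1 := hb.numBalanced_eq
    have h2 := (restrict_sdiff_eq_deleteEdges G X ▸ hb.restrict _ :
      (G.deleteEdges X).Balanced).numBalanced_eq
    simp only [hb, not_true_eq_false, false_imp_iff, true_imp_iff, true_and]
    omega
  · simp only [hb, not_false_eq_true, false_imp_iff, true_imp_iff, and_true]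
    omega

theorem isCocircuit_iff (G : SignedGraph α β) (X : Set β) :
    G.IsCocircuit X ↔ G.matroid✶.IsCircuit X := by
  rw [IsCocircuit, Matroid.isCircuit_def, show G.IsCutset = G.matroid✶.Dep from
    funext fun X ↦ propext (G.isCutset_iff X)]

theorem Connected.genHammingWeight_dual_of_not_balanced {G : SignedGraph α β} (hG : G.Connected)
    (hb : ¬ G.Balanced) (r : ℕ) : G.matroid✶.genHammingWeight r = G.cogirth r := by
  rw [Matroid.genHammingWeight, cogirth]
  congr 1
  ext n
  refine exists_congr fun X ↦ and_congr_right fun hX ↦ and_congr_left fun _ ↦ ?_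
  have h := G.nullityNat_dual_matroid hX
  rw [hG.numBalanced_eq_zero hb, add_zero] at h
  rw [h]

theorem Connected.genHammingWeight_dual_of_balanced {G : SignedGraph α β} (hG : G.Connected)
    (hb : G.Balanced) (r : ℕ) : G.matroid✶.genHammingWeight r = G.edgeConnectivity r := by
  rw [Matroid.genHammingWeight, edgeConnectivity]
  congr 1
  ext n
  refine exists_congr fun X ↦ and_congr_right fun hX ↦ and_congr_left fun _ ↦ ?_
  have h := G.nullityNat_dual_matroid hX
  have h2 := (restrict_sdiff_eq_deleteEdges G X ▸ hb.restrict _ :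
      (G.deleteEdges X).Balanced).numBalanced_eq
  -- The single component present at the start accounts for the `+ 1` in `edgeConnectivity`.
  rw [hb.numBalanced_eq, hG.numComponents_eq, h2] at h
  omega

end SignedGraph

/-! ### Cutting and gluing simple paths, and passing between paths and cycles. -/

namespace Graph

variable {α β : Type*}

/-- `W` and `P` are the vertex set and the edge set of a simple path of `G` from `x` to `y`,
possibly of length zero. -/
inductive PathOn (G : Graph α β) : α → α → Set α → Set β → Prop
  | nil (x : α) : PathOn G x x {x} ∅
  | cons {x y z : α} {e : β} {W : Set α} {P : Set β} : G.IsLink e x y → PathOn G y z W P →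
      x ∉ W → PathOn G x z (insert x W) (insert e P)

namespace PathOn

variable {G : Graph α β} {x y z : α} {W W' T : Set α} {P P' : Set β} {e : β}

theorem left_mem (h : G.PathOn x y W P) : x ∈ W := by
  cases h with
  | nil => rfl
  | cons => exact Set.mem_insert _ _

theorem right_mem (h : G.PathOn x y W P) : y ∈ W := by
  induction h with
  | nil => rfl
  | cons _ _ _ ih => exact Set.mem_insert_of_mem _ ih

theorem finite (h : G.PathOn x y W P) : P.Finite := by
  induction h with
  | nil => exact Set.finite_empty
  | cons _ _ _ ih => exact ih.insert _

theorem subset_edgeSet (h : G.PathOn x y W P) : P ⊆ E(G) := by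
  induction h with
  | nil => exact Set.empty_subset _
  | cons hl _ _ ih => exact Set.insert_subset hl.edge_mem ih

theorem mem_of_isLink (h : G.PathOn x y W P) (he : e ∈ P) {a b : α} (hl : G.IsLink e a b) :
    a ∈ W ∧ b ∈ W ∧ a ≠ b := by
  induction h with
  | nil => exact absurd he (Set.notMem_empty e)
  | @cons u v w f W P hf h hu ih =>
    rcases he with rfl | he
    · have hv := h.left_mem
      rcases hf.eq_and_eq_or_eq_and_eq hl with ⟨rfl, rfl⟩ | ⟨rfl, rfl⟩
      · exact ⟨Or.inl rfl, Or.inr hv, fun h ↦ hu (h ▸ hv)⟩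
      · exact ⟨Or.inr hv, Or.inl rfl, fun h ↦ hu (h ▸ hv)⟩
    · exact ⟨Or.inr (ih he).1, Or.inr (ih he).2.1, (ih he).2.2⟩

theorem eq_nil (h : G.PathOn x x W P) : W = {x} ∧ P = ∅ := by
  cases h with
  | nil => exact ⟨rfl, rfl⟩
  | cons _ h hx => exact absurd h.right_mem hx

theorem append (h : G.PathOn x y W P) (h' : G.PathOn y z W' P') (hW : W ∩ W' ⊆ {y}) :
    G.PathOn x z (W ∪ W') (P ∪ P') := by
  induction h with
  | nil x =>
    rw [Set.empty_union, Set.union_eq_self_of_subset_left (Set.singleton_subset_iff.2 h'.left_mem)]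
    exact h'
  | @cons u v w f W P hf h hu ih =>
    rw [Set.insert_union, Set.insert_union]
    refine cons hf (ih h' ((Set.inter_subset_inter_left _ (Set.subset_insert _ _)).trans hW)) ?_
    rintro (hu' | hu')
    · exact hu hu'
    -- A first vertex lying on the second path would be the gluing point, which is on the tail.
    · exact hu (hW ⟨Or.inl rfl, hu'⟩ ▸ h.right_mem)

theorem symm (h : G.PathOn x y W P) : G.PathOn y x W P := by
  induction h with
  | nil x => exact nil x
  | @cons u v w f W P hf h hu ih =>
    have h1 : G.PathOn v u (insert v {u}) (insert f ∅) :=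
      cons hf.symm (nil u) fun hvu ↦ hu (hvu ▸ h.left_mem)
    have h2 := ih.append h1 (by
      rintro a ⟨ha, rfl | rfl⟩
      · rfl
      · exact absurd ha hu)
    rwa [Set.union_insert, Set.union_singleton, Set.insert_eq_of_mem (Set.mem_insert_of_mem u h.left_mem),
      Set.union_insert, Set.union_empty] at h2

/-- A path can be split at each of its vertices. -/
theorem split (h : G.PathOn x y W P) (hz : z ∈ W) : ∃ W₁ P₁ W₂ P₂, G.PathOn x z W₁ P₁ ∧
    G.PathOn z y W₂ P₂ ∧ W₁ ∪ W₂ = W ∧ P₁ ∪ P₂ = P ∧ W₁ ∩ W₂ = {z} ∧ Disjoint P₁ P₂ := by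
  induction h with
  | nil x =>
    obtain rfl := hz
    exact ⟨_, _, _, _, nil z, nil z, by simp, by simp, by simp, by simp⟩
  | @cons u v w f W P hf h hu ih =>
    rcases hz with rfl | hz
    · exact ⟨_, _, _, _, nil z, cons hf h hu, by simp, by simp, by simp, by simp⟩
    · obtain ⟨W₁, P₁, W₂, P₂, h₁, h₂, rfl, rfl, hW, hP⟩ := ih hz
      refine ⟨_, _, _, _, cons hf h₁ fun h ↦ hu (Or.inl h), h₂, Set.insert_union, Set.insert_union,
        ?_, ?_⟩
      · rw [Set.insert_inter_of_notMem fun h ↦ hu (Or.inr h), hW]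
      · rw [Set.disjoint_insert_left]
        exact ⟨fun hf' ↦ hu (Or.inr (h₂.mem_of_isLink hf' hf).1), hP⟩

/-- A path that ends in `T` has an initial part that meets `T` only at its end. -/
theorem exists_first (h : G.PathOn x y W P) (hT : (W ∩ T).Nonempty) :
    ∃ z W₁ P₁ W₂ P₂, G.PathOn x z W₁ P₁ ∧ G.PathOn z y W₂ P₂ ∧ W₁ ∪ W₂ = W ∧ P₁ ∪ P₂ = P ∧
      W₁ ∩ W₂ = {z} ∧ W₁ ∩ T = {z} := by
  induction h with
  | nil x =>
    obtain ⟨_, rfl, hT⟩ := hT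
    exact ⟨_, _, _, _, _, nil _, nil _, by simp, by simp, by simp, by simpa using hT⟩
  | @cons u v w f W P hf h hu ih =>
    by_cases huT : u ∈ T
    · exact ⟨_, _, _, _, _, nil u, cons hf h hu, by simp, by simp, by simp, by simpa using huT⟩
    · rw [Set.insert_inter_of_notMem huT] at hT
      obtain ⟨z, W₁, P₁, W₂, P₂, h₁, h₂, rfl, rfl, hW, hWT⟩ := ih hT
      refine ⟨z, _, _, _, _, cons hf h₁ fun h ↦ hu (Or.inl h), h₂, Set.insert_union,
        Set.insert_union, ?_, ?_⟩
      · rw [Set.insert_inter_of_notMem fun h ↦ hu (Or.inr h), hW]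
      · rw [Set.insert_inter_of_notMem huT, hWT]

/-- A path between disjoint sets contains a path that meets each of them at one end only. -/
theorem exists_between {A B : Set α} (h : G.PathOn x y W P) (hx : x ∈ A) (hy : y ∈ B) :
    ∃ a b W' P', G.PathOn a b W' P' ∧ W' ⊆ W ∧ P' ⊆ P ∧ W' ∩ A = {a} ∧ W' ∩ B = {b} := by
  -- Stop at the first vertex in `B`, then walk back from there to the first vertex in `A`.
  obtain ⟨b, W₁, P₁, W₂, P₂, h₁, -, rfl, rfl, -, hB⟩ := h.exists_first (T := B) ⟨y, h.right_mem, hy⟩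
  obtain ⟨a, W₃, P₃, W₄, P₄, h₃, -, rfl, rfl, -, hA⟩ :=
    h₁.symm.exists_first (T := A) ⟨x, h₁.left_mem, hx⟩
  refine ⟨a, b, W₃, P₃, h₃.symm, fun _ h ↦ Or.inl (Or.inl h), fun _ h ↦ Or.inl (Or.inl h), hA, ?_⟩
  refine Set.Subset.antisymm ?_ ?_
  · rw [← hB]
    exact Set.inter_subset_inter_left _ Set.subset_union_left
  · rintro _ rfl
    exact ⟨h₃.left_mem, (hB.symm ▸ rfl : _ ∈ (W₃ ∪ W₄) ∩ B).2⟩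

/-- If a path has two vertices in `T`, then its parts before the first and after the last of
these vertices are disjoint. -/
theorem exists_ends (h : G.PathOn x y W P) (hT : (W ∩ T).Nontrivial) :
    ∃ u v W₁ P₁ W₂ P₂, u ≠ v ∧ G.PathOn x u W₁ P₁ ∧ G.PathOn v y W₂ P₂ ∧
      P₁ ⊆ P ∧ P₂ ⊆ P ∧ Disjoint W₁ W₂ ∧ W₁ ∩ T = {u} ∧ W₂ ∩ T = {v} := by
  obtain ⟨u, W₁, P₁, W₂, P₂, h₁, h₂, rfl, rfl, hW, huT⟩ := h.exists_first hT.nonempty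
  have hne : (W₂ ∩ (T \ {u})).Nonempty := by
    obtain ⟨a, ha, hau⟩ := hT.exists_ne u
    rcases ha.1 with h | h
    · exact absurd (huT ▸ ⟨h, ha.2⟩ : a ∈ ({u} : Set α)) hau
    · exact ⟨a, h, ha.2, hau⟩
  -- Reversing the remainder makes the last vertex in `T` the first. Removing `u` from `T` forces a
  -- vertex other than `u`.
  obtain ⟨v, W₃, P₃, W₄, P₄, h₃, h₄, rfl, rfl, hW', hvT⟩ := h₂.symm.exists_first hne
  have hv : v ∈ W₃ ∩ (T \ {u}) := hvT.symm ▸ rfl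
  have hu : u ∉ W₃ := fun hu ↦ hv.2.2 (hW' ▸ ⟨hu, h₄.right_mem⟩ : u ∈ ({v} : Set α)).symm
  refine ⟨u, v, W₁, P₁, W₃, P₃, fun h ↦ hv.2.2 h.symm, h₁, h₃.symm, fun _ h ↦ Or.inl h, fun _ h ↦ Or.inr (Or.inl h), ?_, huT, ?_⟩
  · rw [Set.disjoint_left]
    intro a ha ha'
    have : a ∈ ({u} : Set α) := hW ▸ ⟨ha, Or.inl ha'⟩
    exact hu (this ▸ ha')
  · rw [← hvT]
    ext a
    exact ⟨fun ha ↦ ⟨ha.1, ha.2, fun h ↦ hu (h ▸ ha.1)⟩, fun ha ↦ ⟨ha.1, ha.2.1⟩⟩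

theorem exists_fun (h : G.PathOn x y W P) : ∃ (n : ℕ) (v : Fin (n + 1) → α) (e : Fin n → β),
    Function.Injective v ∧ (∀ i : Fin n, G.IsLink (e i) (v i.castSucc) (v i.succ)) ∧
      v 0 = x ∧ v (Fin.last n) = y ∧ Set.range v = W ∧ Set.range e = P := by
  induction h with
  | nil x =>
    exact ⟨0, fun _ ↦ x, Fin.elim0, fun i j _ ↦ Subsingleton.elim (α := Fin 1) i j, fun i ↦ i.elim0, rfl, rfl,
      Set.range_const, Set.range_eq_empty _⟩
  | @cons u w z f W P hf h hu ih =>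
    obtain ⟨n, v, e, hv, hl, h0, hn, rfl, rfl⟩ := ih
    refine ⟨n + 1, Fin.cons u v, Fin.cons f e, Fin.cons_injective_iff.2 ⟨hu, hv⟩, ?_, rfl, ?_,
      Fin.range_cons _ _, Fin.range_cons _ _⟩
    · intro i
      refine Fin.cases ?_ (fun i ↦ ?_) i
      · simpa [h0] using hf
      · simpa [← Fin.succ_castSucc] using hl i
    · rw [← Fin.succ_last, Fin.cons_succ, hn]

theorem isSimplePath (h : G.PathOn x y W P) (hxy : x ≠ y) : G.IsSimplePath x y W P := by
  obtain ⟨n, v, e, hv, hl, h0, hn, hW, hP⟩ := h.exists_fun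
  rcases n with _ | n
  · exact absurd (h0.symm.trans hn) hxy
  · exact ⟨n, v, e, hv, hl, h0, hn, hW, hP⟩

theorem of_fun {n : ℕ} (v : Fin (n + 1) → α) (e : Fin n → β) (hv : Function.Injective v)
    (hl : ∀ i : Fin n, G.IsLink (e i) (v i.castSucc) (v i.succ)) :
    G.PathOn (v 0) (v (Fin.last n)) (Set.range v) (Set.range e) := by
  induction n with
  | zero =>
    have h : Set.range v = {v 0} := Set.range_unique (ι := Fin 1)
    rw [Set.range_eq_empty e, h]
    exact nil (v 0)
  | succ n ih =>
    rw [← Fin.cons_self_tail v, ← Fin.cons_self_tail e, Fin.range_cons, Fin.range_cons]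
    refine cons (hl 0) (ih (Fin.tail v) (Fin.tail e) (hv.comp (Fin.succ_injective _)) fun i ↦ ?_) ?_
    · simpa [Fin.tail] using hl i.succ
    · rintro ⟨i, hi⟩
      exact Fin.succ_ne_zero i (hv hi)

/-- A path together with another edge between its ends is a cycle. -/
theorem isCycle (h : G.PathOn x y W P) (hl : G.IsLink e y x) (he : e ∉ P) :
    G.IsCycle W (insert e P) := by
  obtain ⟨n, v, f, hv, hf, rfl, rfl, rfl, rfl⟩ := h.exists_fun
  -- An edge determines its ends up to order; the reversed order would need `i = j + 1` and `j = i +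
  -- 1`.
  have hinj : ∀ i j : Fin n, f i = f j → i = j := by
    intro i j hij
    have h1 := hf i
    rw [hij] at h1
    rcases h1.eq_and_eq_or_eq_and_eq (hf j) with ⟨h2, -⟩ | ⟨h2, h3⟩
    · exact Fin.castSucc_injective _ (hv h2)
    · have h4 := congrArg Fin.val (hv h2)
      have h5 := congrArg Fin.val (hv h3)
      simp only [Fin.val_castSucc, Fin.val_succ] at h4 h5
      omega
  refine ⟨n, v, Fin.snoc f e, hv, ?_, ?_, rfl, ?_⟩
  · exact Fin.snoc_injective_iff.2 ⟨fun i j ↦ hinj i j, he⟩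
  · intro i
    refine Fin.lastCases ?_ (fun i ↦ ?_) i
    · simpa using hl
    · simpa using hf i
  · ext g
    constructor
    · rintro ⟨i, rfl⟩
      refine Fin.lastCases ?_ (fun i ↦ ?_) i
      · simp
      · simp
    · rintro (rfl | ⟨i, rfl⟩)
      · exact ⟨Fin.last n, by simp⟩
      · exact ⟨i.castSucc, by simp⟩

/-- Two internally disjoint paths with the same ends form a cycle. -/
theorem isCycle_union (h : G.PathOn x y W P) (h' : G.PathOn x y W' P') (hxy : x ≠ y)
    (hW : W ∩ W' ⊆ {x, y}) (hP : Disjoint P P') : G.IsCycle (W ∪ W') (P ∪ P') := by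
  cases h with
  | nil => exact absurd rfl hxy
  | @cons _ z _ f W P hf h hx =>
    -- Set aside the first edge `f` of one path; the rest of it and the reversed other path form a
    -- path which `f` closes.
    have h1 := h.append h'.symm (by
      rintro a ⟨ha, ha'⟩
      rcases hW ⟨Or.inr ha, ha'⟩ with rfl | h
      · exact absurd ha hx
      · exact h)
    rw [Set.insert_union, Set.insert_union,
      Set.insert_eq_of_mem (show x ∈ W ∪ W' from Or.inr h'.left_mem)]
    refine h1.isCycle hf ?_
    -- Edge-disjointness matters here: both paths could consist of the same single edge.
    rintro (h2 | h2)
    · exact hx (h.mem_of_isLink h2 hf).1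
    · exact Set.disjoint_left.1 hP (Set.mem_insert f P) h2

theorem restrict {X : Set β} (h : G.PathOn x y W P) (hP : P ⊆ X) :
    (G.restrict X).PathOn x y W P := by
  induction h with
  | nil x => exact nil x
  | cons hf h hu ih =>
    exact cons ⟨hP (Set.mem_insert _ _), hf⟩ (ih ((Set.subset_insert _ _).trans hP)) hu

theorem of_restrict {X : Set β} (h : (G.restrict X).PathOn x y W P) :
    G.PathOn x y W P ∧ P ⊆ X := by
  induction h with
  | nil x => exact ⟨nil x, Set.empty_subset _⟩
  | cons hf h hu ih => exact ⟨cons hf.2 ih.1 hu, Set.insert_subset hf.1 ih.2⟩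

end PathOn

theorem exists_pathOn {G : Graph α β} {x y : α} (h : G.Reach x y) : ∃ W P, G.PathOn x y W P := by
  induction h using Relation.ReflTransGen.head_induction_on with
  | refl => exact ⟨_, _, .nil y⟩
  | @head x z hl _ ih =>
    obtain ⟨e, he⟩ := hl
    obtain ⟨W, P, h⟩ := ih
    by_cases hx : x ∈ W
    · obtain ⟨W₁, P₁, W₂, P₂, -, h₂, -⟩ := h.split hx
      exact ⟨W₂, P₂, h₂⟩
    · exact ⟨_, _, .cons he h hx⟩

theorem IsSimplePath.pathOn {G : Graph α β} {x y : α} {W : Set α} {P : Set β}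
    (h : G.IsSimplePath x y W P) : G.PathOn x y W P := by
  obtain ⟨n, v, e, hv, hl, rfl, rfl, rfl, rfl⟩ := h
  exact .of_fun v e hv hl

/-- A cycle minus one of its edges is a path. -/
theorem IsCycle.pathOn_sdiff {G : Graph α β} {W : Set α} {C : Set β} (h : G.IsCycle W C)
    {f : β} (hf : f ∈ C) : ∃ x y, G.IsLink f y x ∧ G.PathOn x y W (C \ {f}) := by
  obtain ⟨n, v, e, hv, he, hl, rfl, rfl⟩ := h
  obtain ⟨k, rfl⟩ := hf
  -- Rotate the indices by `k + 1`, so that the removed edge becomes the closing one.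
  have hlast : k + 1 + Fin.last n = k := by
    rw [add_assoc, add_comm 1, Fin.last_add_one, add_zero]
  have h1 := PathOn.of_fun (G := G) (fun i : Fin (n + 1) ↦ v (k + 1 + i))
    (fun i : Fin n ↦ e (k + 1 + i.castSucc)) (hv.comp (add_right_injective (k + 1))) (fun i ↦ by
      simpa [← Fin.coeSucc_eq_succ, add_assoc] using hl (k + 1 + i.castSucc))
  have h2 : Set.range (fun i : Fin (n + 1) ↦ v (k + 1 + i)) = Set.range v :=
    (Equiv.addLeft (k + 1)).surjective.range_comp v
  have h3 : Set.range (fun i : Fin n ↦ e (k + 1 + i.castSucc)) = Set.range e \ {e k} := by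
    ext g
    constructor
    · rintro ⟨i, rfl⟩
      refine ⟨⟨_, rfl⟩, fun h ↦ ?_⟩
      have h4 := he h
      nth_rewrite 2 [← hlast] at h4
      exact (Fin.castSucc_lt_last i).ne (add_left_cancel h4)
    · rintro ⟨⟨j, rfl⟩, hj⟩
      obtain ⟨i, rfl⟩ := (Equiv.addLeft (k + 1)).surjective j
      refine Fin.lastCases (fun hj ↦ ?_) (fun i _ ↦ ⟨i, rfl⟩) i hj
      exact absurd (by simp only [Equiv.coe_addLeft, hlast]; rfl) hj
  simp only [hlast, add_zero, h2, h3] at h1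
  exact ⟨v (k + 1), v k, hl k, h1⟩

theorem IsCycle.mem_of_isLink {G : Graph α β} {W : Set α} {C : Set β} (h : G.IsCycle W C)
    {e : β} (he : e ∈ C) {a b : α} (hl : G.IsLink e a b) : a ∈ W ∧ b ∈ W := by
  obtain ⟨x, y, hxy, hp⟩ := h.pathOn_sdiff he
  rcases hxy.eq_and_eq_or_eq_and_eq hl with ⟨rfl, rfl⟩ | ⟨rfl, rfl⟩
  · exact ⟨hp.right_mem, hp.left_mem⟩
  · exact ⟨hp.left_mem, hp.right_mem⟩

/-- A cycle passes through each of its vertices: it consists of a path that starts there, and of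
an edge from the end of the path back to its start. -/
theorem IsCycle.exists_pathOn {G : Graph α β} {W : Set α} {C : Set β} (h : G.IsCycle W C)
    {x : α} (hx : x ∈ W) : ∃ f ∈ C, ∃ y, G.IsLink f y x ∧ G.PathOn x y W (C \ {f}) := by
  have hmem : ∃ f ∈ C, ∃ z, G.IsLink f z x := by
    obtain ⟨n, v, e, hv, he, hl, rfl, rfl⟩ := h
    obtain ⟨i, rfl⟩ := hx
    exact ⟨e i, ⟨i, rfl⟩, _, (hl i).symm⟩
  obtain ⟨f, hf, z, hl⟩ := hmem
  obtain ⟨a, b, hab, hp⟩ := h.pathOn_sdiff hf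
  rcases hab.eq_and_eq_or_eq_and_eq hl with ⟨rfl, rfl⟩ | ⟨rfl, rfl⟩
  · exact ⟨f, hf, _, hl, hp⟩
  · exact ⟨f, hf, _, hl, hp.symm⟩

/-- Removing the loop leaves a simple path with equal ends, which has no edge. -/
theorem IsCycle.eq_singleton_of_isLink {G : Graph α β} {W : Set α} {C : Set β}
    (h : G.IsCycle W C) {e : β} (he : e ∈ C) {x : α} (hl : G.IsLink e x x) : C = {e} := by
  obtain ⟨a, b, hab, hp⟩ := h.pathOn_sdiff he
  obtain ⟨rfl, rfl⟩ : b = x ∧ a = x := by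
    rcases hab.eq_and_eq_or_eq_and_eq hl with h | h
    · exact h
    · exact h
  have h1 := hp.eq_nil.2
  exact Set.Subset.antisymm (Set.sdiff_eq_empty.1 h1) (Set.singleton_subset_iff.2 he)

end Graph

/-! ### Signs of edge sets. -/

namespace SignedGraph

variable {α β : Type*}

/-- The product of the signs of a finite set of edges. -/
noncomputable def signProd (G : SignedGraph α β) (C : Set β) : ℤˣ :=
  (-1) ^ {e ∈ C | G.sign e = -1}.ncard

theorem evenNeg_iff_signProd (G : SignedGraph α β) (C : Set β) :
    G.EvenNeg C ↔ G.signProd C = 1 := by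
  rw [EvenNeg, signProd]
  generalize {e ∈ C | G.sign e = -1}.ncard = k
  rcases Nat.even_or_odd k with h | h
  · simp [h, h.neg_one_pow]
  · simp [h, h.neg_one_pow]

theorem not_evenNeg_iff_signProd (G : SignedGraph α β) (C : Set β) :
    ¬ G.EvenNeg C ↔ G.signProd C = -1 := by
  rw [evenNeg_iff_signProd]
  rcases Int.units_eq_one_or (G.signProd C) with h | h <;> simp [h]

theorem signProd_empty (G : SignedGraph α β) : G.signProd ∅ = 1 := by
  simp [signProd]

theorem signProd_union (G : SignedGraph α β) {C D : Set β} (hC : C.Finite) (hD : D.Finite)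
    (h : Disjoint C D) : G.signProd (C ∪ D) = G.signProd C * G.signProd D := by
  rw [signProd, signProd, signProd, ← pow_add, ← Set.ncard_union_eq (h.mono (Set.sep_subset _ _)
    (Set.sep_subset _ _)) (hC.subset (Set.sep_subset _ _)) (hD.subset (Set.sep_subset _ _))]
  congr 2
  ext e
  exact or_and_right

theorem signProd_singleton (G : SignedGraph α β) (e : β) : G.signProd {e} = G.sign e := by
  rw [signProd]
  rcases Int.units_eq_one_or (G.sign e) with h | h
  · have : {f ∈ ({e} : Set β) | G.sign f = -1} = ∅ := by
      refine Set.eq_empty_of_forall_notMem ?_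
      rintro _ ⟨rfl, hf⟩
      rw [h] at hf
      exact absurd hf (by decide)
    rw [this, Set.ncard_empty, h, pow_zero]
  · have : {f ∈ ({e} : Set β) | G.sign f = -1} = {e} :=
      Set.sep_eq_self_iff_mem_true.2 fun f hf ↦ by rw [Set.mem_singleton_iff.1 hf, h]
    rw [this, Set.ncard_singleton, h, pow_one]

theorem signProd_insert (G : SignedGraph α β) {C : Set β} (hC : C.Finite) {e : β} (he : e ∉ C) :
    G.signProd (insert e C) = G.sign e * G.signProd C := by
  rw [Set.insert_eq, G.signProd_union (Set.finite_singleton e) hC (Set.disjoint_singleton_left.2 he),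
    signProd_singleton]

theorem exists_sWalk_of_pathOn (G : SignedGraph α β) {x y : α} {W : Set α} {P : Set β}
    (h : G.graph.PathOn x y W P) : ∃ n, G.SWalk n (G.signProd P) x y := by
  induction h with
  | nil x => exact ⟨0, by rw [signProd_empty]; exact .nil x⟩
  | @cons x y z e W P hl h hx ih =>
    obtain ⟨n, hn⟩ := ih
    refine ⟨n + 1, ?_⟩
    rw [G.signProd_insert h.finite fun he ↦ hx (h.mem_of_isLink he hl).1]
    exact .cons hl hn

/-! ### Potentials -/

/-- A function on the vertices which is orthogonal to the columns of the edges in `X`. -/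
def IsPotential (G : SignedGraph α β) (X : Set β) (u : α → ℚ) : Prop :=
  ∀ e ∈ X, ∀ a b, G.graph.IsLink e a b → u a = ((G.sign e : ℤ) : ℚ) * u b

theorem IsPotential.mono {G : SignedGraph α β} {X Y : Set β} {u : α → ℚ}
    (h : G.IsPotential Y u) (hXY : X ⊆ Y) : G.IsPotential X u :=
  fun e he ↦ h e (hXY he)

theorem isPotential_insert {G : SignedGraph α β} {X : Set β} {u : α → ℚ} {e : β} :
    G.IsPotential (insert e X) u ↔ G.IsPotential {e} u ∧ G.IsPotential X u := by
  simp only [IsPotential, Set.forall_mem_insert, Set.mem_singleton_iff, forall_eq]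

theorem isPotential_singleton {G : SignedGraph α β} {u : α → ℚ} {e : β} {a b : α}
    (hl : G.graph.IsLink e a b) :
    G.IsPotential {e} u ↔ u a = ((G.sign e : ℤ) : ℚ) * u b := by
  refine ⟨fun h ↦ h e rfl a b hl, ?_⟩
  rintro h _ rfl c d hl'
  rcases hl.eq_and_eq_or_eq_and_eq hl' with ⟨rfl, rfl⟩ | ⟨rfl, rfl⟩
  · exact h
  · rw [h, ← mul_assoc, sign_mul_self, one_mul]

theorem mem_leftKernel_restrict_iff (G : SignedGraph α β) (X : Set β) (u : α → ℚ) :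
    (fun x : V(G.graph) ↦ u x) ∈ (G.restrict X).leftKernel ↔ G.IsPotential X u :=
  ⟨fun h e he a b hl ↦ h e ⟨a, hl.left_mem⟩ ⟨b, hl.right_mem⟩ ⟨he, hl⟩,
    fun h e a b hl ↦ h e hl.1 a b hl.2⟩

theorem exists_extend (G : SignedGraph α β) (y : V(G.graph) → ℚ) :
    ∃ u : α → ℚ, (fun x : V(G.graph) ↦ u x) = y := by
  classical
  exact ⟨fun x ↦ if h : x ∈ V(G.graph) then y ⟨x, h⟩ else 0, funext fun x ↦ dif_pos x.2⟩

/-- An edge is in the closure of `X` if and only if every potential of `X` is a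
potential of the edge. -/
theorem mem_closure_iff (G : SignedGraph α β) {X : Set β} (hX : X ⊆ E(G.graph)) {e : β}
    (he : e ∈ E(G.graph)) :
    e ∈ G.matroid.closure X ↔ ∀ u, G.IsPotential X u → G.IsPotential {e} u := by
  have : Finite V(G.graph) := G.finite_vertexSet.to_subtype
  let K : Submodule ℚ (V(G.graph) → ℚ) := (G.restrict X).leftKernel
  let K' : Submodule ℚ (V(G.graph) → ℚ) := (G.restrict (insert e X)).leftKernel
  have hle : K' ≤ K := by
    intro y hy
    obtain ⟨u, rfl⟩ := G.exists_extend y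
    exact (G.mem_leftKernel_restrict_iff X u).2
      (((G.mem_leftKernel_restrict_iff (insert e X) u).1 hy).mono (Set.subset_insert e X))
  have h1 : K' = K ↔ ∀ u, G.IsPotential X u → G.IsPotential {e} u := by
    constructor
    · intro h u hu
      have h2 : (fun x : V(G.graph) ↦ u x) ∈ K' :=
        h ▸ (G.mem_leftKernel_restrict_iff X u).2 hu
      exact (isPotential_insert.1 ((G.mem_leftKernel_restrict_iff _ u).1 h2)).1
    · refine fun h ↦ le_antisymm hle fun y hy ↦ ?_
      obtain ⟨u, rfl⟩ := G.exists_extend y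
      have h2 := (G.mem_leftKernel_restrict_iff X u).1 hy
      exact (G.mem_leftKernel_restrict_iff _ u).2 (isPotential_insert.2 ⟨h u h2, h2⟩)
  -- The kernels are nested and their dimensions are `|V|` minus the ranks, so they agree iff the
  -- rank does not grow.
  have h2 : K' = K ↔ G.matroid.rkNat (insert e X) = G.matroid.rkNat X := by
    have hK : Module.finrank ℚ K = (G.restrict X).numBalanced := finrank_leftKernel (G.restrict X)
    have hK' : Module.finrank ℚ K' = (G.restrict (insert e X)).numBalanced :=
      finrank_leftKernel (G.restrict (insert e X))
    have h3 := G.rkNat_matroid hX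
    have h4 := G.rkNat_matroid (Set.insert_subset he hX)
    constructor
    · intro h
      rw [h] at hK'
      omega
    · intro h
      exact Submodule.eq_of_le_of_finrank_eq hle (by omega)
  rw [← h1, h2]
  have hfin : ∀ Y ⊆ E(G.graph), G.matroid.eRk Y ≠ ⊤ := fun Y hY ↦
    ((G.matroid.eRk_le_encard Y).trans_lt (G.finite_edgeSet.subset hY).encard_lt_top).ne
  constructor
  · intro h
    rw [Matroid.rkNat, Matroid.rkNat, ← G.matroid.eRk_insert_closure_eq, Set.insert_eq_of_mem h,
      G.matroid.eRk_closure_eq]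
  · intro h
    by_contra hcon
    have h3 := G.matroid.eRk_insert_eq_add_one (X := X) ⟨he, hcon⟩
    rw [Matroid.rkNat, Matroid.rkNat, h3, ENat.toNat_add (hfin X hX) (by simp)] at h
    simp at h

/-- Each edge multiplies the value by its sign. This propagation is the basis of all later arguments
with potentials. -/
theorem IsPotential.pathOn {G : SignedGraph α β} {u : α → ℚ} {x y : α} {W : Set α} {P : Set β}
    (hu : G.IsPotential P u) (h : G.graph.PathOn x y W P) :
    u x = ((G.signProd P : ℤ) : ℚ) * u y := by
  induction h with
  | nil x => simp [signProd_empty]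
  | @cons x y z e W P hl h hx ih =>
    rw [G.signProd_insert h.finite fun he ↦ hx (h.mem_of_isLink he hl).1,
      hu e (Set.mem_insert e P) x y hl, ih (hu.mono (Set.subset_insert e P))]
    push_cast
    ring

theorem IsPotential.eq_zero_of_pathOn_right {G : SignedGraph α β} {u : α → ℚ} {x y : α}
    {W : Set α} {P : Set β} (hu : G.IsPotential P u) (h : G.graph.PathOn x y W P) (hy : u y = 0) :
    ∀ w ∈ W, u w = 0 := by
  intro w hw
  obtain ⟨W₁, P₁, W₂, P₂, -, h₂, -, rfl, -⟩ := h.split hw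
  rw [(hu.mono Set.subset_union_right).pathOn h₂, hy, mul_zero]

theorem IsPotential.eq_zero_of_pathOn {G : SignedGraph α β} {u : α → ℚ} {x y z : α}
    {W : Set α} {P : Set β} (hu : G.IsPotential P u) (h : G.graph.PathOn x y W P) (hz : z ∈ W)
    (huz : u z = 0) : ∀ w ∈ W, u w = 0 := by
  intro w hw
  obtain ⟨W₁, P₁, W₂, P₂, h₁, h₂, rfl, rfl, -⟩ := h.split hz
  rcases hw with hw | hw
  · exact (hu.mono Set.subset_union_left).eq_zero_of_pathOn_right h₁ huz w hw
  · exact (hu.mono Set.subset_union_right).eq_zero_of_pathOn_right h₂.symm huz w hw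

/-- A potential of a path with one edge removed vanishes if it vanishes at both ends. -/
theorem IsPotential.eq_zero_of_pathOn_sdiff {G : SignedGraph α β} {u : α → ℚ} {x y : α}
    {W : Set α} {P : Set β} {e : β} (h : G.graph.PathOn x y W P)
    (hu : G.IsPotential (P \ {e}) u) (hx : u x = 0) (hy : u y = 0) : ∀ w ∈ W, u w = 0 := by
  induction h with
  | nil x => rintro _ rfl; exact hx
  | @cons x z y f W P hl h hxW ih =>
    rintro w (rfl | hw)
    · exact hx
    by_cases hfe : f = e
    · subst hfe
      -- Beyond the removed edge the zero comes from `y`; before it, from `x`. By simplicity the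
      -- edge does not recur in the tail.
      refine (hu.mono ?_).eq_zero_of_pathOn_right h hy w hw
      exact fun g hg ↦ ⟨Or.inr hg, fun hgf ↦ hxW (h.mem_of_isLink hg (hgf ▸ hl)).1⟩
    · refine ih (hu.mono (Set.sdiff_subset_sdiff_left (Set.subset_insert f P))) ?_ hy w hw
      rw [hu f ⟨Or.inl rfl, hfe⟩ _ _ hl.symm, hx, mul_zero]

/-- A potential vanishes on unbalanced cycles. -/
theorem IsPotential.eq_zero_of_isCycle {G : SignedGraph α β} {u : α → ℚ} {W : Set α} {C : Set β}
    (hu : G.IsPotential C u) (h : G.graph.IsCycle W C) (hC : ¬ G.EvenNeg C) :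
    ∀ w ∈ W, u w = 0 := by
  obtain ⟨f, hf⟩ := h.nonempty
  obtain ⟨x, y, hl, hp⟩ := h.pathOn_sdiff hf
  -- Going once round the cycle gives `u y = -u y`.
  have h1 := (hu.mono Set.sdiff_subset).pathOn hp
  have h2 := hu f hf _ _ hl
  have h3 := G.signProd_insert hp.finite (e := f) (by simp)
  rw [Set.insert_sdiff_singleton, Set.insert_eq_of_mem hf,
    (G.not_evenNeg_iff_signProd C).1 hC] at h3
  have h4 : u y = 0 := by
    rw [h1, ← mul_assoc, ← Int.cast_mul, ← Units.val_mul, ← h3] at h2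
    push_cast at h2
    linarith
  exact (hu.mono Set.sdiff_subset).eq_zero_of_pathOn_right hp h4

theorem IsPotential.singleton_of_eq_zero {G : SignedGraph α β} {u : α → ℚ} {e : β} {a b : α}
    (hl : G.graph.IsLink e a b) (ha : u a = 0) (hb : u b = 0) : G.IsPotential {e} u := by
  rw [isPotential_singleton hl, ha, hb, mul_zero]

/-- If `u` is a potential of a cycle minus an edge and vanishes at some vertex of the cycle, then
it is a potential of the edge. -/
theorem IsPotential.singleton_of_isCycle {G : SignedGraph α β} {u : α → ℚ} {W : Set α}
    {C : Set β} {e : β} {w : α} (h : G.graph.IsCycle W C) (he : e ∈ C)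
    (hu : G.IsPotential (C \ {e}) u) (hw : w ∈ W) (huw : u w = 0) : G.IsPotential {e} u := by
  obtain ⟨x, y, hl, hp⟩ := h.pathOn_sdiff he
  have h0 := hu.eq_zero_of_pathOn hp hw huw
  exact .singleton_of_eq_zero hl (h0 _ hp.right_mem) (h0 _ hp.left_mem)

/-! ### Balanced cycles and bowties have no coloops -/

theorem IsBalancedCycle.subset_edgeSet {G : SignedGraph α β} {C : Set β}
    (h : G.IsBalancedCycle C) : C ⊆ E(G.graph) := by
  obtain ⟨W, hC, -⟩ := h
  exact hC.subset_edgeSet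

/-- Without `e` the cycle is a path between the ends of `e` with the same sign as `e`, so
propagation along it is the relation demanded by `e`. -/
theorem IsBalancedCycle.isPotential {G : SignedGraph α β} {C : Set β} (h : G.IsBalancedCycle C)
    {e : β} (he : e ∈ C) {u : α → ℚ} (hu : G.IsPotential (C \ {e}) u) : G.IsPotential {e} u := by
  obtain ⟨W, hC, hb⟩ := h
  obtain ⟨x, y, hl, hp⟩ := hC.pathOn_sdiff he
  have h3 := G.signProd_insert hp.finite (e := e) (by simp)
  rw [Set.insert_sdiff_singleton, Set.insert_eq_of_mem he, (G.evenNeg_iff_signProd C).1 hb] at h3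
  have h4 : G.signProd (C \ {e}) = G.sign e := by
    rcases Int.units_eq_one_or (G.sign e) with h | h <;> rw [h] at h3 ⊢
    · rw [one_mul] at h3
      exact h3.symm
    · rw [h3, neg_mul, one_mul, neg_neg]
  rw [isPotential_singleton hl.symm, hu.pathOn hp, h4]

theorem IsBowtie.subset_edgeSet {G : SignedGraph α β} {B : Set β}
    (h : G.IsBowtie B) : B ⊆ E(G.graph) := by
  obtain ⟨W₁, C₁, W₂, C₂, h₁, -, h₂, -, ⟨-, -, rfl⟩ | ⟨-, x, y, W, P, hp, -, -, rfl⟩⟩ := h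
  · exact Set.union_subset h₁.subset_edgeSet h₂.subset_edgeSet
  · exact Set.union_subset (Set.union_subset h₁.subset_edgeSet h₂.subset_edgeSet)
      hp.pathOn.subset_edgeSet

/-- Edges of a simple path have distinct ends; those of a common edge would both be the single
common vertex. -/
theorem disjoint_of_isCycle_of_pathOn {G : Graph α β} {W₁ W : Set α} {C P : Set β} {x y z : α}
    (hC : G.IsCycle W₁ C) (hP : G.PathOn x y W P) (hW : W ∩ W₁ = {z}) : Disjoint C P := by
  rw [Set.disjoint_left]
  intro f hf hfP
  obtain ⟨a, b, hl⟩ := G.exists_isLink_of_mem_edgeSet (hP.subset_edgeSet hfP)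
  obtain ⟨ha, hb, hab⟩ := hP.mem_of_isLink hfP hl
  obtain ⟨ha', hb'⟩ := hC.mem_of_isLink hf hl
  have h1 : a ∈ ({z} : Set α) := hW ▸ ⟨ha, ha'⟩
  have h2 : b ∈ ({z} : Set α) := hW ▸ ⟨hb, hb'⟩
  exact hab (h1.trans h2.symm)

theorem disjoint_of_isCycle {G : Graph α β} {W₁ W₂ : Set α} {C₁ C₂ : Set β}
    (h₁ : G.IsCycle W₁ C₁) (h₂ : G.IsCycle W₂ C₂) (hW : Disjoint W₁ W₂) : Disjoint C₁ C₂ := by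
  rw [Set.disjoint_left]
  intro f hf hf'
  obtain ⟨a, b, hl⟩ := G.exists_isLink_of_mem_edgeSet (h₁.subset_edgeSet hf)
  exact Set.disjoint_left.1 hW (h₁.mem_of_isLink hf hl).1 (h₂.mem_of_isLink hf' hl).1

/-- An unbalanced cycle that avoids `e` stays intact and forces the value zero on it. The zeros
spread through the rest of the bowtie to both ends of `e`, where the relation is then trivial. -/
theorem IsBowtie.isPotential {G : SignedGraph α β} {B : Set β} (h : G.IsBowtie B)
    {e : β} (he : e ∈ B) {u : α → ℚ} (hu : G.IsPotential (B \ {e}) u) : G.IsPotential {e} u := by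
  obtain ⟨W₁, C₁, W₂, C₂, h₁, hu₁, h₂, hu₂,
    ⟨hC, ⟨x, hx⟩, rfl⟩ | ⟨hW, x, y, W, P, hp, hx, hy, rfl⟩⟩ := h
  · have hxW : x ∈ W₁ ∩ W₂ := hx.symm ▸ rfl
    rcases he with he | he
    · have h0 := (hu.mono fun f hf ↦ ⟨Or.inr hf,
        fun hfe ↦ Set.disjoint_left.1 hC he (hfe ▸ hf)⟩).eq_zero_of_isCycle h₂ hu₂
      exact .singleton_of_isCycle h₁ he
        (hu.mono (Set.sdiff_subset_sdiff_left Set.subset_union_left)) hxW.1 (h0 x hxW.2)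
    · have h0 := (hu.mono fun f hf ↦ ⟨Or.inl hf,
        fun hfe ↦ Set.disjoint_left.1 hC hf (hfe ▸ he)⟩).eq_zero_of_isCycle h₁ hu₁
      exact .singleton_of_isCycle h₂ he
        (hu.mono (Set.sdiff_subset_sdiff_left Set.subset_union_right)) hxW.2 (h0 x hxW.1)
  · replace hp := hp.pathOn
    have hC := disjoint_of_isCycle h₁ h₂ hW
    have hP₁ := disjoint_of_isCycle_of_pathOn h₁ hp hx
    have hP₂ := disjoint_of_isCycle_of_pathOn h₂ hp hy
    have hxW : x ∈ W ∩ W₁ := hx.symm ▸ rfl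
    have hyW : y ∈ W ∩ W₂ := hy.symm ▸ rfl
    have hz₁ : e ∉ C₁ → ∀ w ∈ W₁, u w = 0 := fun hn ↦ (hu.mono fun f hf ↦
      ⟨Or.inl (Or.inl hf), fun hfe ↦ hn (hfe ▸ hf)⟩).eq_zero_of_isCycle h₁ hu₁
    have hz₂ : e ∉ C₂ → ∀ w ∈ W₂, u w = 0 := fun hn ↦ (hu.mono fun f hf ↦
      ⟨Or.inl (Or.inr hf), fun hfe ↦ hn (hfe ▸ hf)⟩).eq_zero_of_isCycle h₂ hu₂
    have hzP : e ∉ P → G.IsPotential P u := fun hn ↦ hu.mono fun f hf ↦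
      ⟨Or.inr hf, fun hfe ↦ hn (hfe ▸ hf)⟩
    rcases he with (he | he) | he
    · have h0 := (hzP (Set.disjoint_left.1 hP₁ he)).eq_zero_of_pathOn hp hyW.1
        (hz₂ (Set.disjoint_left.1 hC he) y hyW.2)
      exact .singleton_of_isCycle h₁ he (hu.mono (Set.sdiff_subset_sdiff_left
        (Set.subset_union_left.trans Set.subset_union_left))) hxW.2 (h0 x hxW.1)
    · have h0 := (hzP (Set.disjoint_left.1 hP₂ he)).eq_zero_of_pathOn hp hxW.1
        (hz₁ (Set.disjoint_right.1 hC he) x hxW.2)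
      exact .singleton_of_isCycle h₂ he (hu.mono (Set.sdiff_subset_sdiff_left
        (Set.subset_union_right.trans Set.subset_union_left))) hyW.2 (h0 y hyW.1)
    -- With `e` on the path both cycles are intact, so the path without `e` is anchored at zeros on
    -- both sides.
    · have h0 := IsPotential.eq_zero_of_pathOn_sdiff hp
        (hu.mono (Set.sdiff_subset_sdiff_left Set.subset_union_right))
        (hz₁ (Set.disjoint_right.1 hP₁ he) x hxW.2) (hz₂ (Set.disjoint_right.1 hP₂ he) y hyW.2)
      obtain ⟨a, b, hl⟩ := G.graph.exists_isLink_of_mem_edgeSet (hp.subset_edgeSet he)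
      obtain ⟨ha, hb, -⟩ := hp.mem_of_isLink he hl
      exact .singleton_of_eq_zero hl (h0 a ha) (h0 b hb)

/-- Having no coloops is all that the weight formula requires; minimality of balanced cycles and
bowties is not needed. -/
theorem mem_closure_sdiff_of_isBalancedCycle_or_isBowtie {G : SignedGraph α β} {B : Set β}
    (h : G.IsBalancedCycle B ∨ G.IsBowtie B) :
    B ⊆ E(G.graph) ∧ ∀ e ∈ B, e ∈ G.matroid.closure (B \ {e}) := by
  have hB : B ⊆ E(G.graph) := h.elim (·.subset_edgeSet) (·.subset_edgeSet)
  refine ⟨hB, fun e he ↦ ?_⟩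
  rw [G.mem_closure_iff (Set.sdiff_subset.trans hB) (hB he)]
  exact fun u hu ↦ h.elim (·.isPotential he hu) (·.isPotential he hu)

end SignedGraph

/-! ### Circuits are balanced cycles or bowties. -/

namespace SignedGraph

variable {α β : Type*}

/-- If `e` is in the closure of `X`, and `X` and `e` contain no balanced cycle, then there is an
unbalanced cycle in the component of an end of `e`. -/
theorem exists_unbalanced_cycle {G : SignedGraph α β} {X : Set β} (hX : X ⊆ E(G.graph)) {e : β}
    {a b : α} (hl : G.graph.IsLink e a b) (heX : e ∉ X) (hcl : e ∈ G.matroid.closure X)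
    (hnb : ∀ C ⊆ insert e X, ¬ G.IsBalancedCycle C) :
    ∃ W C, G.graph.IsCycle W C ∧ C ⊆ X ∧ ¬ G.EvenNeg C ∧
      ∀ w ∈ W, (G.restrict X).graph.Reach a w := by
  classical
  by_contra hcon
  -- Otherwise the component of `a` is balanced, and the signs of walks from `a` define a potential
  -- `u` on it, extended by zero.
  have hS : {w | (G.restrict X).graph.Reach a w} ∈ (G.restrict X).balancedComponents := by
    refine ⟨⟨a, hl.left_mem, rfl⟩, fun W C hC hW ↦ ?_⟩
    by_contra hu
    obtain ⟨hC, hCX⟩ := Graph.isCycle_restrict.1 hC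
    exact hcon ⟨W, C, hC, hCX, hu, hW⟩
  have haS : a ∈ {w | (G.restrict X).graph.Reach a w} := Relation.ReflTransGen.refl
  let R : ℤˣ → α → Prop := fun s x ↦ ∃ n, (G.restrict X).SWalk n s a x
  have huniq : ∀ {s t x}, R s x → R t x → s = t := by
    rintro s t x ⟨n, hn⟩ ⟨m, hm⟩
    exact sign_unique hS haS hn hm
  have hstep : ∀ {f p q s}, f ∈ X → G.graph.IsLink f p q → R s p → R (G.sign f * s) q := by
    rintro f p q s hf hfl ⟨n, hn⟩
    have h := hn.trans (SWalk.cons (G := G.restrict X) ⟨hf, hfl⟩ (.nil q))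
    rw [mul_one, mul_comm] at h
    exact ⟨_, h⟩
  let u : α → ℚ := fun x ↦ if R 1 x then 1 else if R (-1) x then -1 else 0
  have hu : ∀ {s x}, R s x → u x = ((s : ℤ) : ℚ) := by
    intro s x h
    rcases Int.units_eq_one_or s with rfl | rfl
    · simp [u, h]
    · have h1 : ¬ R 1 x := fun h1 ↦ absurd (huniq h1 h) (by decide)
      simp [u, h, h1]
  have hu0 : ∀ {x}, (∀ s, ¬ R s x) → u x = 0 := by
    intro x h
    simp [u, h]
  have hpot : G.IsPotential X u := by
    intro f hf p q hfl
    by_cases hq : ∃ s, R s q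
    · obtain ⟨s, hs⟩ := hq
      rw [hu hs, hu (hstep hf hfl.symm hs)]
      push_cast
      rfl
    · push Not at hq
      rw [hu0 hq, hu0 fun s hs ↦ hq _ (hstep hf hfl hs), mul_zero]
  have ha : R 1 a := ⟨0, .nil a⟩
  have h1 := (isPotential_singleton hl).1 ((G.mem_closure_iff hX hl.edge_mem).1 hcl u hpot)
  rw [hu ha] at h1
  -- Since `u a = 1`, the relation of `e` forces `u b ≠ 0`. So `b` is in the component, and a path
  -- from `b` to `a` has the sign of `e`: the two form a balanced cycle.
  by_cases hb : ∃ s, R s b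
  · obtain ⟨s, n, hs⟩ := hb
    obtain ⟨W, P, hp⟩ := Graph.exists_pathOn hs.symm.reach
    obtain ⟨m, hm⟩ := (G.restrict X).exists_sWalk_of_pathOn hp
    have h2 : R (G.signProd P) b := ⟨m, hm.symm⟩
    obtain ⟨hp, hPX⟩ := hp.of_restrict
    refine hnb (insert e P) (Set.insert_subset_insert hPX) ⟨W, hp.isCycle hl fun h ↦ heX (hPX h), ?_⟩
    rw [evenNeg_iff_signProd, G.signProd_insert hp.finite fun h ↦ heX (hPX h)]
    rw [hu h2] at h1
    exact_mod_cast h1.symm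
  · push Not at hb
    rw [hu0 hb, mul_zero] at h1
    simp at h1

/-- Two unbalanced cycles that meet in more than one vertex: there is a balanced cycle in their
union. -/
theorem exists_balanced_of_nontrivial {G : SignedGraph α β} {W₁ W₂ : Set α} {C₁ C₂ : Set β}
    (h₁ : G.graph.IsCycle W₁ C₁) (h₂ : G.graph.IsCycle W₂ C₂) (hu₂ : ¬ G.EvenNeg C₂) {e : β}
    (he₁ : e ∈ C₁) (he₂ : e ∉ C₂) (hW : (W₁ ∩ W₂).Nontrivial) :
    ∃ C ⊆ C₁ ∪ C₂, G.IsBalancedCycle C := by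
  obtain ⟨x, y, hl, hp⟩ := h₁.pathOn_sdiff he₁
  obtain ⟨u, v, Wx, Px, Wy, Py, huv, hpx, hpy, hPx, hPy, hdisj, hxu, hyv⟩ :=
    hp.exists_ends hW
  -- the part of the first cycle through `e` whose inner vertices are not on the second cycle
  have hear : G.graph.PathOn u v (Wx ∪ Wy) (Px ∪ insert e Py) := by
    have h3 := Graph.PathOn.cons hl.symm hpy.symm fun h ↦
      Set.disjoint_left.1 hdisj hpx.left_mem h
    have h4 := hpx.symm.append h3 (by
      rintro a ⟨ha, rfl | ha'⟩
      · rfl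
      · exact absurd ha' (Set.disjoint_left.1 hdisj ha))
    rwa [Set.union_insert, Set.insert_eq_of_mem (show x ∈ Wx ∪ Wy from Or.inl hpx.left_mem)] at h4
  have hearW : (Wx ∪ Wy) ∩ W₂ = {u, v} := by
    rw [Set.union_inter_distrib_right, hxu, hyv, Set.singleton_union]
  have hearC : Disjoint (Px ∪ insert e Py) C₂ := by
    have hno : ∀ {a b c : α} {W : Set α} {P : Set β}, G.graph.PathOn a b W P → W ∩ W₂ = {c} →
        Disjoint P C₂ := fun h h' ↦ (disjoint_of_isCycle_of_pathOn h₂ h h').symm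
    exact (hno hpx hxu).union_left (Set.disjoint_insert_left.2 ⟨he₂, hno hpy hyv⟩)
  have hear₁ : Px ∪ insert e Py ⊆ C₁ := Set.union_subset (hPx.trans Set.sdiff_subset)
    (Set.insert_subset he₁ (hPy.trans Set.sdiff_subset))
  -- the two parts of the second cycle
  have hu : u ∈ W₂ := (hearW.symm ▸ Or.inl rfl : u ∈ (Wx ∪ Wy) ∩ W₂).2
  have hv : v ∈ W₂ := (hearW.symm ▸ Or.inr rfl : v ∈ (Wx ∪ Wy) ∩ W₂).2
  obtain ⟨f, hf, c, hfl, hq⟩ := h₂.exists_pathOn hu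
  obtain ⟨Wa, Pa, Wb, Pb, hqa, hqb, hWab, hPab, hab, hPd⟩ := hq.split hv
  have hub : u ∉ Wb := fun h ↦ huv (hab ▸ ⟨hqa.left_mem, h⟩ : u ∈ ({v} : Set α))
  have hqb' := Graph.PathOn.cons hfl.symm hqb.symm hub
  have hfP : f ∉ Pa ∪ Pb := by
    rw [hPab]
    simp
  have hC₂ : Pa ∪ insert f Pb = C₂ := by
    rw [Set.union_insert, hPab, Set.insert_sdiff_singleton, Set.insert_eq_of_mem hf]
  have hsign : G.signProd Pa * G.signProd (insert f Pb) = -1 := by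
    rw [← G.signProd_union hqa.finite hqb'.finite, hC₂, ← not_evenNeg_iff_signProd]
    · exact hu₂
    · exact Set.disjoint_insert_right.2 ⟨fun h ↦ hfP (Or.inl h), hPd⟩
  have key : ∀ {W : Set α} {P : Set β}, G.graph.PathOn u v W P → W ⊆ W₂ → P ⊆ C₂ →
      G.signProd (Px ∪ insert e Py) = G.signProd P → ∃ C ⊆ C₁ ∪ C₂, G.IsBalancedCycle C := by
    intro W P h hWW hPC hs
    have hd : Disjoint (Px ∪ insert e Py) P := hearC.mono_right hPC
    refine ⟨_, Set.union_subset_union hear₁ hPC, _, hear.isCycle_union h huv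
      ((Set.inter_subset_inter_right _ hWW).trans hearW.subset) hd, ?_⟩
    rw [evenNeg_iff_signProd, G.signProd_union hear.finite h.finite hd, hs, Int.units_mul_self]
  -- The two arcs of the second cycle have opposite signs, so one of them has the sign of the ear
  -- and closes it to a balanced cycle.
  have hcase : G.signProd (Px ∪ insert e Py) = G.signProd Pa ∨
      G.signProd (Px ∪ insert e Py) = G.signProd (insert f Pb) := by
    revert hsign
    generalize G.signProd Pa = s
    generalize G.signProd (insert f Pb) = t
    generalize G.signProd (Px ∪ insert e Py) = w
    revert s t w
    decide
  rcases hcase with h | h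
  · exact key hqa (hWab ▸ Set.subset_union_left) (hC₂ ▸ Set.subset_union_left) h
  · exact key hqb' (Set.insert_subset hu (hWab ▸ Set.subset_union_right))
      (hC₂ ▸ Set.subset_union_right) h

/-- Every circuit is a balanced cycle or a bowtie. -/
theorem isBalancedCycle_or_isBowtie_of_isCircuit {G : SignedGraph α β} {C : Set β}
    (hC : G.matroid.IsCircuit C) : G.IsBalancedCycle C ∨ G.IsBowtie C := by
  have hCE : C ⊆ E(G.graph) := hC.subset_ground
  -- A nonempty set without coloops is dependent, so inside the circuit it is everything.
  have hmin : ∀ B ⊆ C, B.Nonempty → G.IsBalancedCycle B ∨ G.IsBowtie B →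
      G.IsBalancedCycle C ∨ G.IsBowtie C := by
    intro B hBC ⟨e, he⟩ hB
    have h1 := (mem_closure_sdiff_of_isBalancedCycle_or_isBowtie hB).2 e he
    have h2 : ¬ G.matroid.Indep B := fun h ↦ h.notMem_closure_sdiff_of_mem he h1
    rwa [← hC.eq_of_not_indep_subset h2 hBC]
  by_cases hnb : ∃ B ⊆ C, G.IsBalancedCycle B
  · obtain ⟨B, hBC, hB⟩ := hnb
    obtain ⟨W, hW, -⟩ := id hB
    exact hmin B hBC hW.nonempty (Or.inl hB)
  push Not at hnb
  have hex : ∀ e ∈ C, ∀ a b, G.graph.IsLink e a b → ∃ W D, G.graph.IsCycle W D ∧ D ⊆ C \ {e} ∧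
      ¬ G.EvenNeg D ∧ ∀ w ∈ W, (G.restrict (C \ {e})).graph.Reach a w := fun e he a b hl ↦
    exists_unbalanced_cycle (Set.sdiff_subset.trans hCE) hl (by simp)
      (hC.mem_closure_sdiff_singleton_of_mem he) fun D hD ↦ hnb D (by
        rwa [Set.insert_sdiff_singleton, Set.insert_eq_of_mem he] at hD)
  obtain ⟨e₀, he₀⟩ := hC.nonempty
  obtain ⟨a₀, b₀, hl₀⟩ := G.graph.exists_isLink_of_mem_edgeSet (hCE he₀)
  obtain ⟨W₁, C₁, h₁, hC₁, hu₁, -⟩ := hex e₀ he₀ a₀ b₀ hl₀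
  replace hC₁ : C₁ ⊆ C := hC₁.trans Set.sdiff_subset
  -- The edge `e₀` served only to find a first cycle. Choosing `e` on that cycle makes the second
  -- cycle different from it, yet joined to an end of `e` within `C`.
  obtain ⟨e, he⟩ := h₁.nonempty
  obtain ⟨a, b, hl⟩ := G.graph.exists_isLink_of_mem_edgeSet (h₁.subset_edgeSet he)
  obtain ⟨W₂, C₂, h₂, hC₂, hu₂, hreach⟩ := hex e (hC₁ he) a b hl
  have he₂ : e ∉ C₂ := fun h ↦ (hC₂ h).2 rfl
  replace hC₂ : C₂ ⊆ C := hC₂.trans Set.sdiff_subset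
  rcases (W₁ ∩ W₂).eq_empty_or_nonempty with hW | hW
  · have ha : a ∈ W₁ := (h₁.mem_of_isLink he hl).1
    obtain ⟨f, hf⟩ := h₂.nonempty
    obtain ⟨w, z, hfl⟩ := G.graph.exists_isLink_of_mem_edgeSet (h₂.subset_edgeSet hf)
    have hw : w ∈ W₂ := (h₂.mem_of_isLink hf hfl).1
    obtain ⟨W, P, hp⟩ := Graph.exists_pathOn (hreach w hw)
    obtain ⟨hp, hPC⟩ := hp.of_restrict
    obtain ⟨x, y, W', P', hp', -, hP', hx, hy⟩ := hp.exists_between ha hw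
    have hdisj : Disjoint W₁ W₂ := Set.disjoint_iff_inter_eq_empty.2 hW
    have hxy : x ≠ y := by
      rintro rfl
      exact Set.disjoint_left.1 hdisj (hx.symm ▸ rfl : x ∈ W' ∩ W₁).2 (hy.symm ▸ rfl : x ∈ W' ∩ W₂).2
    refine hmin (C₁ ∪ C₂ ∪ P') (Set.union_subset (Set.union_subset hC₁ hC₂)
      (hP'.trans (hPC.trans Set.sdiff_subset))) ⟨e, Or.inl (Or.inl he)⟩ (Or.inr ?_)
    exact ⟨W₁, C₁, W₂, C₂, h₁, hu₁, h₂, hu₂,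
      Or.inr ⟨hdisj, x, y, W', P', hp'.isSimplePath hxy, hx, hy, rfl⟩⟩
  rcases hW.exists_eq_singleton_or_nontrivial with ⟨x, hx⟩ | hW
  -- A common edge would be a loop at the common vertex, hence all of the first cycle, hence equal
  -- to `e`, which the second cycle avoids.
  · have hdisj : Disjoint C₁ C₂ := by
      rw [Set.disjoint_left]
      intro f hf hf'
      obtain ⟨p, q, hfl⟩ := G.graph.exists_isLink_of_mem_edgeSet (h₁.subset_edgeSet hf)
      have h3 := h₁.mem_of_isLink hf hfl
      have h4 := h₂.mem_of_isLink hf' hfl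
      obtain rfl : p = x := hx.subset ⟨h3.1, h4.1⟩
      obtain rfl : q = p := hx.subset ⟨h3.2, h4.2⟩
      rw [h₁.eq_singleton_of_isLink hf hfl] at he
      exact he₂ (he ▸ hf')
    exact hmin (C₁ ∪ C₂) (Set.union_subset hC₁ hC₂) ⟨e, Or.inl he⟩
      (Or.inr ⟨W₁, C₁, W₂, C₂, h₁, hu₁, h₂, hu₂, Or.inl ⟨hdisj, ⟨x, hx⟩, rfl⟩⟩)
  · obtain ⟨D, hD, hb⟩ := exists_balanced_of_nontrivial h₁ h₂ hu₂ he he₂ hW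
    exact absurd hb (hnb D (hD.trans (Set.union_subset hC₁ hC₂)))

end SignedGraph

theorem mainTheorem8 {α β : Type*} (G : SignedGraph α β) (hG : G.Connected) (r : ℕ) (hr : 1 ≤ r) :
    (r ≤ G.matroid.nullityNat G.matroid.E →
      IsLeast {n : ℕ | ∃ C : Fin r → Set β, (∀ i, G.IsBalancedCycle (C i) ∨ G.IsBowtie (C i)) ∧
        NonRedundant C ∧ (⋃ i, C i).ncard = n} (G.matroid.genHammingWeight r)) ∧
    (r ≤ G.matroid.rkNat G.matroid.E →
      (¬ G.Balanced → G.matroid✶.genHammingWeight r = G.cogirth r) ∧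
      (G.Balanced → G.matroid✶.genHammingWeight r = G.edgeConnectivity r)) ∧
    (r ≤ G.matroid.rkNat G.matroid.E →
      IsLeast {n : ℕ | ∃ C : Fin r → Set β, (∀ i, G.IsCocircuit (C i)) ∧
        NonRedundant C ∧ (⋃ i, C i).ncard = n} (G.matroid✶.genHammingWeight r)) := by
  refine ⟨fun h ↦ ?_, fun _ ↦ ⟨fun hb ↦ hG.genHammingWeight_dual_of_not_balanced hb r,
    fun hb ↦ hG.genHammingWeight_dual_of_balanced hb r⟩, fun h ↦ ?_⟩
  · exact Matroid.isLeast_genHammingWeight G.finite_edgeSet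
      (p := fun C ↦ G.IsBalancedCycle C ∨ G.IsBowtie C)
      (fun C ↦ SignedGraph.isBalancedCycle_or_isBowtie_of_isCircuit)
      (fun C hC ↦ (SignedGraph.mem_closure_sdiff_of_isBalancedCycle_or_isBowtie hC).1)
      (fun C hC ↦ (SignedGraph.mem_closure_sdiff_of_isBalancedCycle_or_isBowtie hC).2) h
  · rw [← G.nullityNat_dual_matroid_ground] at h
    exact Matroid.isLeast_genHammingWeight (N := G.matroid✶) G.finite_edgeSet
      (p := G.IsCocircuit) (fun C ↦ (G.isCocircuit_iff C).2)
      (fun C hC ↦ ((G.isCocircuit_iff C).1 hC).subset_ground)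
      (fun C hC e ↦ ((G.isCocircuit_iff C).1 hC).mem_closure_sdiff_singleton_of_mem) h
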